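/- Let $n,m\in\mathbb{N}=\{1,2,\dots\}$, $\sigma>0$, let $B=\{x\in\mathbb{R}^n:|x|<1\}$, and put $b_{m,\sigma}(x)=|x|^{2m}(1+|\log|x||)^{2\sigma}$. Let $E^m_{2,\sigma}(B)$ be the complex Hilbert space obtained as the completion of $C^m_0(B)$ (complex-valued $C^m$ functions on $\mathbb{R}^n$ with compact support in $B$) with respect to the norm $$\|f\,|\,E^m_{2,\sigma}(B)\|=\Big(\int_B b_{m,\sigma}(x)\sum_{|\alpha|=m}|D^\alpha f(x)|^2\,dx\Big)^{1/2},$$ and let $\operatorname{id}:E^m_{2,\sigma}(B)\hookrightarrow L_2(B)$ be the (bounded, injective) embedding extending the inclusion $C^m_0(B)\subset L_2(B)$. For $k\in\mathbb{N}$ let $a_k(\operatorname{id})=\inf\{\|\operatorname{id}-S\|: S:E^m_{2,\sigma}(B)\to L_2(B)\text{ linear and bounded},\ \operatorname{rank}S<k\}$. For $\varepsilon>0$ let $$\nu_0(\varepsilon,B)=\max\{k\in\mathbb{N}:a_k(\operatorname{id})\ge\varepsilon\}$$ (and $\nu_0(\varepsilon,B)=0$ if there is no such $k$), and $$\mu_0(\varepsilon,B)=\max\Big\{\dim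 S:\ \sup_{u\in S\setminus\{0\}}\frac{\|u\,|\,E^m_{2,\sigma}(B)\|}{\|u\,|\,L_2(B)\|}\le\frac1\varepsilon\Big\},$$ the maximum being taken over all finite-dimensional linear subspaces $S$ of $E^m_{2,\sigma}(B)$. Let $A^m_\sigma f=(-1)^m\sum_{|\alpha|=m}D^\alpha(b_{m,\sigma}D^\alpha f)$ be the operator in $L_2(B)$ generated by the inner product of $E^m_{2,\sigma}(B)$: $f\in\operatorname{dom}A^m_\sigma$ and $A^m_\sigma f=h$ if and only if $f\in E^m_{2,\sigma}(B)$, $h\in L_2(B)$ and $(h,\operatorname{id}g)_{L_2(B)}=(f,g)_{E^m_{2,\sigma}(B)}$ for all $g\in E^m_{2,\sigma}(B)$. Then $\operatorname{id}$ is compact, and for every $\varepsilon>0$ the numbers $\nu_0(\varepsilon,B)$ and $\mu_0(\varepsilon,B)$ are finite and $$\nu_0(\varepsilon,B)=\mu_0(\varepsilon,B).$$ The operator $A^m_\sigma$ is self-adjoint and positive definite (that is, $(A^m_\sigma f,f)_{L_2(B)}\ge c\,\|f\|_{L_2(B)}^2$ on its domain, for some $c>0$) and has pure point spectrum: its spectrum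 consists of isolated eigenvalues of finite multiplicity, and its eigenvectors span a dense subspace of $L_2(B)$. Its eigenvalues form a non-decreasing real sequence $(\lambda_k(A^m_\sigma))_{k=1}^\infty$ tending to infinity, in which each eigenvalue is repeated according to its geometric multiplicity, and for every $\varepsilon>0$ $$\nu_0(\varepsilon,B)=N(\varepsilon^{-2},A^m_\sigma),$$ where $N(\lambda,A^m_\sigma)=\#\{k:\lambda_k(A^m_\sigma)\le\lambda\}$. -/

import Mathlib

open MeasureTheory
open scoped ENNReal ContDiff

noncomputable section

namespace DegSobolev

/-- The Euclidean space `ℝⁿ`. -/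
abbrev Rn (n : ℕ) := EuclideanSpace ℝ (Fin n)

/-- Lebesgue measure on the open unit ball `B` of `ℝⁿ`. -/
abbrev ballMeasure (n : ℕ) : Measure (Rn n) := volume.restrict (Metric.ball 0 1)

instance (n : ℕ) : IsFiniteMeasure (ballMeasure n) :=
  ⟨by rw [Measure.restrict_apply_univ]; exact measure_ball_lt_top⟩

/-- The complex Hilbert space `L₂(B)`. -/
abbrev L2B (n : ℕ) := Lp ℂ 2 (ballMeasure n)

/-- The multi-indices `α ∈ ℕ₀ⁿ` with `|α| = m`. -/
abbrev MultiIndex (n m : ℕ) := ↥(Finset.piAntidiag (Finset.univ : Finset (Fin n)) m)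

variable {n : ℕ}

/-- The classical partial derivative `∂u/∂xᵢ`. -/
def partialDeriv (i : Fin n) (u : Rn n → ℂ) : Rn n → ℂ :=
  fun x => fderiv ℝ u x (EuclideanSpace.single i 1)

/-- The iterated partial derivative `∂_{i₁} ⋯ ∂_{iₖ} u` along a list `[i₁, …, iₖ]`. -/
def listDeriv (l : List (Fin n)) (u : Rn n → ℂ) : Rn n → ℂ :=
  l.foldr partialDeriv u

/-- `D^α u = ∂₁^{α₁} ⋯ ∂ₙ^{αₙ} u`. -/
def multiDeriv (α : Fin n → ℕ) (u : Rn n → ℂ) : Rn n → ℂ :=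
  listDeriv ((List.finRange n).flatMap fun i => List.replicate (α i) i) u

/-- The space `C₀ᵐ(B)`: complex-valued functions of class `Cᵐ` on `ℝⁿ` with compact support
contained in `B`. -/
def testSpace (n m : ℕ) : Submodule ℂ (Rn n → ℂ) where
  carrier := {u | ContDiff ℝ m u ∧ HasCompactSupport u ∧ tsupport u ⊆ Metric.ball 0 1}
  add_mem' := by
    rintro u v ⟨hu, hu', hu''⟩ ⟨hv, hv', hv''⟩
    exact ⟨hu.add hv, hu'.add hv', (tsupport_add u v).trans (Set.union_subset hu'' hv'')⟩
  zero_mem' := ⟨contDiff_const, HasCompactSupport.zero, by simp [tsupport]⟩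
  smul_mem' := by
    rintro c u ⟨hu, hu', hu''⟩
    exact ⟨contDiff_const.smul hu, hu'.smul_left (f := fun _ => c),
      (tsupport_smul_subset_right (fun _ => c) u).trans hu''⟩

/-- The weight `b_{m,σ}(x) = |x|^{2m} (1 + |log |x||)^{2σ}` (the case `p = 2`). -/
def weight (m : ℕ) (σ : ℝ) (x : Rn n) : ℝ :=
  ‖x‖ ^ (2 * m) * (1 + |Real.log ‖x‖|) ^ (2 * σ)

/-! ### Calculus of partial derivatives -/

lemma listDeriv_cons (i : Fin n) (l : List (Fin n)) (u : Rn n → ℂ) :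
    listDeriv (i :: l) u = partialDeriv i (listDeriv l u) := rfl

lemma contDiff_partialDeriv {k : ℕ} (i : Fin n) {u : Rn n → ℂ} (hu : ContDiff ℝ (k + 1 : ℕ) u) :
    ContDiff ℝ k (partialDeriv i u) := by
  have h : ContDiff ℝ k (fderiv ℝ u) := hu.fderiv_right (by norm_cast)
  exact h.clm_apply contDiff_const

lemma contDiff_listDeriv {k : ℕ} (l : List (Fin n)) {u : Rn n → ℂ}
    (hu : ContDiff ℝ (l.length + k : ℕ) u) : ContDiff ℝ k (listDeriv l u) := by
  induction l generalizing k with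
  | nil => simpa [listDeriv] using hu
  | cons i l ih =>
    rw [listDeriv_cons]
    refine contDiff_partialDeriv i (ih ?_)
    have : l.length + (k + 1) = (i :: l).length + k := by simp; omega
    rwa [this]

lemma tsupport_partialDeriv (i : Fin n) (u : Rn n → ℂ) :
    tsupport (partialDeriv i u) ⊆ tsupport u := by
  refine (closure_mono ?_).trans (tsupport_fderiv_subset ℝ (f := u))
  intro x hx h
  apply hx
  simp [partialDeriv, h]

lemma tsupport_listDeriv (l : List (Fin n)) (u : Rn n → ℂ) :
    tsupport (listDeriv l u) ⊆ tsupport u := by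
  induction l with
  | nil => exact subset_rfl
  | cons i l ih => exact (tsupport_partialDeriv i _).trans ih

lemma hasCompactSupport_listDeriv (l : List (Fin n)) {u : Rn n → ℂ} (hu : HasCompactSupport u) :
    HasCompactSupport (listDeriv l u) :=
  hu.of_isClosed_subset isClosed_closure (tsupport_listDeriv l u)

lemma partialDeriv_add (i : Fin n) {u v : Rn n → ℂ} (hu : ContDiff ℝ 1 u) (hv : ContDiff ℝ 1 v) :
    partialDeriv i (u + v) = partialDeriv i u + partialDeriv i v := by
  ext x
  simp only [partialDeriv, Pi.add_apply]
  rw [fderiv_add (hu.differentiable (by simp) x) (hv.differentiable (by simp) x)]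
  rfl

lemma partialDeriv_smul (i : Fin n) (c : ℂ) {u : Rn n → ℂ} (hu : ContDiff ℝ 1 u) :
    partialDeriv i (c • u) = c • partialDeriv i u := by
  ext x
  simp only [partialDeriv, Pi.smul_apply]
  rw [fderiv_const_smul (hu.differentiable (by simp) x)]
  rfl

lemma listDeriv_add (l : List (Fin n)) {u v : Rn n → ℂ} (hu : ContDiff ℝ l.length u)
    (hv : ContDiff ℝ l.length v) : listDeriv l (u + v) = listDeriv l u + listDeriv l v := by
  induction l with
  | nil => rfl
  | cons i l ih =>
    simp only [List.length_cons] at hu hv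
    rw [listDeriv_cons, ih (hu.of_le (by norm_cast; omega)) (hv.of_le (by norm_cast; omega)),
      partialDeriv_add i (contDiff_listDeriv l hu) (contDiff_listDeriv l hv)]
    rfl

lemma listDeriv_smul (l : List (Fin n)) (c : ℂ) {u : Rn n → ℂ} (hu : ContDiff ℝ l.length u) :
    listDeriv l (c • u) = c • listDeriv l u := by
  induction l with
  | nil => rfl
  | cons i l ih =>
    simp only [List.length_cons] at hu
    rw [listDeriv_cons, ih (hu.of_le (by norm_cast; omega)),
      partialDeriv_smul i c (contDiff_listDeriv l hu)]
    rfl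

lemma partialDeriv_comm (i j : Fin n) {u : Rn n → ℂ} (hu : ContDiff ℝ 2 u) :
    partialDeriv i (partialDeriv j u) = partialDeriv j (partialDeriv i u) := by
  have hd : ∀ x, DifferentiableAt ℝ (fderiv ℝ u) x := fun x =>
    (hu.fderiv_right (m := 1) (by norm_num)).differentiable (by simp) x
  have key : ∀ (a b : Fin n) (x : Rn n), partialDeriv a (partialDeriv b u) x =
      fderiv ℝ (fderiv ℝ u) x (EuclideanSpace.single a 1) (EuclideanSpace.single b 1) := by
    intro a b x
    change fderiv ℝ (fun y => fderiv ℝ u y (EuclideanSpace.single b 1)) x _ = _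
    rw [fderiv_clm_apply (hd x) (differentiableAt_const _)]
    simp
  ext x
  rw [key, key]
  exact (hu.contDiffAt.isSymmSndFDerivAt (by simp)).eq _ _

lemma listDeriv_perm {l l' : List (Fin n)} (h : l.Perm l') {u : Rn n → ℂ}
    (hu : ContDiff ℝ l.length u) : listDeriv l u = listDeriv l' u := by
  induction h with
  | nil => rfl
  | cons i h ih =>
    rw [listDeriv_cons, listDeriv_cons, ih (hu.of_le (by simp))]
  | swap i j l =>
    simp only [listDeriv_cons]
    exact partialDeriv_comm _ _ (contDiff_listDeriv (k := 2) l hu)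
  | trans h₁ h₂ ih₁ ih₂ =>
    rw [ih₁ hu, ih₂ (by rwa [← h₁.length_eq])]

lemma length_multi (α : Fin n → ℕ) :
    ((List.finRange n).flatMap fun i => List.replicate (α i) i).length = ∑ i, α i := by
  rw [List.length_flatMap]
  simp [List.sum_ofFn, List.finRange, Function.comp_def]

lemma multi_perm (l : List (Fin n)) :
    l.Perm ((List.finRange n).flatMap fun i => List.replicate (l.count i) i) := by
  rw [List.perm_iff_count]
  intro a
  rw [List.count_flatMap]
  have : (List.map (List.count a ∘ fun i => List.replicate (List.count i l) i)
      (List.finRange n)).sum = ∑ i, (if i = a then l.count i else 0) := by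
    rw [← List.sum_ofFn, List.ofFn_eq_map]
    congr 1
    refine List.map_congr_left fun i _ => ?_
    simp [List.count_replicate]
  rw [this]
  simp

lemma contDiff_multiDeriv {m : ℕ} (α : MultiIndex n m) {u : Rn n → ℂ} (hu : ContDiff ℝ m u) :
    Continuous (multiDeriv α.1 u) := by
  have hα : ∑ i, α.1 i = m := (Finset.mem_piAntidiag.1 α.2).1
  refine (contDiff_listDeriv (k := 0) _ ?_).continuous
  rw [length_multi, hα]; exact hu

/-- Every iterated derivative of order `m` is one of the `D^α u` with `|α| = m`. -/
lemma exists_multiDeriv_eq {m : ℕ} (l : List (Fin n)) (hl : l.length = m) :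
    ∃ α : MultiIndex n m, ∀ u : Rn n → ℂ, ContDiff ℝ m u → listDeriv l u = multiDeriv α.1 u := by
  have hp := multi_perm l
  refine ⟨⟨fun i => l.count i, ?_⟩, fun u hu => ?_⟩
  · rw [Finset.mem_piAntidiag]
    refine ⟨?_, by simp⟩
    rw [← length_multi, ← hp.length_eq, hl]
  · exact listDeriv_perm hp (by rw [hl]; exact hu)


/-! ### Hardy's inequality -/

lemma sum_coord_smul (x : Rn n) : ∑ i, x i • (EuclideanSpace.single i (1 : ℝ) : Rn n) = x := by
  have := (EuclideanSpace.basisFun (Fin n) ℝ).sum_repr x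
  simpa using this

lemma fderiv_apply_eq_sum {G : Type*} [NormedAddCommGroup G] [NormedSpace ℝ G]
    (T : Rn n →L[ℝ] G) (x : Rn n) : T x = ∑ i, x i • T (EuclideanSpace.single i 1) := by
  conv_lhs => rw [← sum_coord_smul x]
  simp only [map_sum, map_smul]

lemma integral_fderiv_radial {F : Rn n → ℝ} (hF : ContDiff ℝ 1 F) (hc : HasCompactSupport F) :
    ∫ x, fderiv ℝ F x x = -(n * ∫ x, F x) := by
  have hcF : Continuous (fderiv ℝ F) := hF.continuous_fderiv (by simp)
  have hsF : HasCompactSupport (fderiv ℝ F) := hc.fderiv (𝕜 := ℝ)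
  have hsi : ∀ i : Fin n, HasCompactSupport fun x => fderiv ℝ F x (EuclideanSpace.single i 1) :=
    fun i => hsF.comp_left (g := fun T : Rn n →L[ℝ] ℝ => T (EuclideanSpace.single i 1)) (by simp)
  have hI : ∀ i : Fin n,
      Integrable fun x : Rn n => x i * fderiv ℝ F x (EuclideanSpace.single i 1) := fun i =>
    Continuous.integrable_of_hasCompactSupport (by fun_prop) ((hsi i).mul_left)
  have hpr : ∀ (i : Fin n) (x : Rn n),
      HasFDerivAt (fun y : Rn n => y i) (EuclideanSpace.proj (𝕜 := ℝ) i) x := fun i x =>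
    (EuclideanSpace.proj (𝕜 := ℝ) i : Rn n →L[ℝ] ℝ).hasFDerivAt
  have h1 : ∀ i : Fin n, ∫ x : Rn n, x i * fderiv ℝ F x (EuclideanSpace.single i 1)
      = -∫ x, F x := by
    intro i
    rw [integral_mul_fderiv_eq_neg_fderiv_mul_of_integrable]
    · congr 1
      refine integral_congr_ae (Filter.Eventually.of_forall fun x => ?_)
      simp [(hpr i x).fderiv]
    · have : (fun x : Rn n => fderiv ℝ (fun y : Rn n => y i) x (EuclideanSpace.single i 1) * F x)
          = F := by
        ext x; simp [(hpr i x).fderiv]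
      rw [this]; exact hF.continuous.integrable_of_hasCompactSupport hc
    · exact hI i
    · exact Continuous.integrable_of_hasCompactSupport
        (by have := hF.continuous; fun_prop) hc.mul_left
    · exact fun x _ => (hpr i x).differentiableAt
    · exact fun x _ => hF.differentiable (by simp) x
  have h2 : ∀ x : Rn n, fderiv ℝ F x x =
      ∑ i, x i * fderiv ℝ F x (EuclideanSpace.single i 1) := fun x => by
    simpa using fderiv_apply_eq_sum (fderiv ℝ F x) x
  simp_rw [h2]
  rw [integral_finsetSum _ fun i _ => hI i]
  simp [h1]

/-- One step of Hardy's inequality. -/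
lemma hardy_step [NeZero n] (j : ℕ) {v : Rn n → ℂ} (hv : ContDiff ℝ 1 v)
    (hc : HasCompactSupport v) :
    ∫ x : Rn n, ‖x‖ ^ (2 * j) * ‖v x‖ ^ 2 ≤
      4 * ∑ i, ∫ x : Rn n, ‖x‖ ^ (2 * (j + 1)) * ‖partialDeriv i v x‖ ^ 2 := by
  have hcv := hv.continuous
  have hdv : Continuous (fderiv ℝ v) := hv.continuous_fderiv (by simp)
  set F : Rn n → ℝ := fun x => (‖x‖ ^ 2) ^ j * ‖v x‖ ^ 2 with hF
  have hF1 : ContDiff ℝ 1 F := ((contDiff_norm_sq ℝ).pow j).mul (hv.norm_sq ℝ)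
  have hFc : HasCompactSupport F :=
    (hc.comp_left (g := fun z : ℂ => ‖z‖ ^ 2) (by simp)).mul_left
  have hder : ∀ x : Rn n, fderiv ℝ F x x =
      2 * j * F x + (‖x‖ ^ 2) ^ j * (2 * inner ℝ (v x) (fderiv ℝ v x x)) := by
    intro x
    have h1 : HasFDerivAt (fun y : Rn n => ‖y‖ ^ 2) (2 • (innerSL ℝ x)) x := by
      simpa using (hasStrictFDerivAt_norm_sq x).hasFDerivAt
    have h2 : HasFDerivAt v (fderiv ℝ v x) x := (hv.differentiable (by simp) x).hasFDerivAt
    have h3 := (h1.pow j).mul h2.norm_sq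
    have h4 : fderiv ℝ F x = _ := h3.fderiv
    rw [h4]
    simp only [hF, smul_eq_mul, nsmul_eq_mul, add_apply,
      smul_apply, innerSL_apply_apply, real_inner_self_eq_norm_sq,
      ContinuousLinearMap.comp_apply]
    rcases j with _ | j
    · simp
    · simp
      ring
  have hFint : Integrable F := hF1.continuous.integrable_of_hasCompactSupport hFc
  have hdc : ∀ i, Integrable fun x : Rn n => ‖x‖ ^ (2 * (j + 1)) * ‖partialDeriv i v x‖ ^ 2 := by
    intro i
    have hp : HasCompactSupport (partialDeriv i v) :=
      hc.of_isClosed_subset isClosed_closure (tsupport_partialDeriv i v)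
    have hpc : Continuous (partialDeriv i v) := (contDiff_partialDeriv (k := 0) i hv).continuous
    exact Continuous.integrable_of_hasCompactSupport (by fun_prop)
      ((hp.comp_left (g := fun z : ℂ => ‖z‖ ^ 2) (by simp)).mul_left)
  have hcs : ∀ x : Rn n, ‖fderiv ℝ v x x‖ ^ 2 ≤ ‖x‖ ^ 2 * ∑ i, ‖partialDeriv i v x‖ ^ 2 := by
    intro x
    have h1 : ‖fderiv ℝ v x x‖ ≤ ∑ i, |x i| * ‖partialDeriv i v x‖ := by
      rw [fderiv_apply_eq_sum (fderiv ℝ v x) x]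
      refine (norm_sum_le _ _).trans (le_of_eq ?_)
      simp [partialDeriv]
    have h2 := Finset.sum_mul_sq_le_sq_mul_sq Finset.univ (fun i => |x i|)
      (fun i => ‖partialDeriv i v x‖)
    have h3 : ‖x‖ ^ 2 = ∑ i, |x i| ^ 2 := by
      rw [EuclideanSpace.norm_sq_eq]; simp
    rw [h3]
    exact (pow_le_pow_left₀ (norm_nonneg _) h1 2).trans h2
  have hpt : ∀ x : Rn n, -fderiv ℝ F x x ≤ (1 / 2 : ℝ) * F x +
      2 * ∑ i, ‖x‖ ^ (2 * (j + 1)) * ‖partialDeriv i v x‖ ^ 2 := by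
    intro x
    rw [hder x, ← Finset.mul_sum]
    have hi : -inner ℝ (v x) (fderiv ℝ v x x) ≤ ‖v x‖ * ‖fderiv ℝ v x x‖ :=
      (neg_le_abs _).trans (abs_real_inner_le_norm _ _)
    have h5 : -(2 * inner ℝ (v x) (fderiv ℝ v x x)) ≤
        1 / 2 * ‖v x‖ ^ 2 + 2 * (‖x‖ ^ 2 * ∑ i, ‖partialDeriv i v x‖ ^ 2) := by
      nlinarith [hcs x, sq_nonneg (‖v x‖ - 2 * ‖fderiv ℝ v x x‖)]
    have h6 : 0 ≤ (‖x‖ ^ 2) ^ j := by positivity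
    have h7 := mul_le_mul_of_nonneg_left h5 h6
    have h8 : 0 ≤ 2 * (j : ℝ) * F x := by simp only [hF]; positivity
    have h9 : ‖x‖ ^ (2 * (j + 1)) = (‖x‖ ^ 2) ^ j * ‖x‖ ^ 2 := by
      rw [pow_mul, pow_succ]
    rw [h9]
    simp only [hF] at h8 ⊢
    nlinarith
  have hInt : Integrable fun x => fderiv ℝ F x x := by
    have hcF : Continuous (fderiv ℝ F) := hF1.continuous_fderiv (by simp)
    refine Continuous.integrable_of_hasCompactSupport (by fun_prop) ?_
    refine (hFc.fderiv (𝕜 := ℝ)).of_isClosed_subset isClosed_closure (closure_mono ?_)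
    intro x hx h
    apply hx
    simp [h]
  have hmono := integral_mono hInt.neg
    ((hFint.const_mul (1 / 2)).add ((integrable_finsetSum Finset.univ fun i _ => hdc i).const_mul 2))
    (fun x => hpt x)
  simp only [Pi.neg_apply, Pi.add_apply] at hmono
  rw [integral_neg, integral_fderiv_radial hF1 hFc, integral_add (hFint.const_mul _)
    ((integrable_finsetSum Finset.univ fun i _ => hdc i).const_mul 2), integral_const_mul,
    integral_const_mul, integral_finsetSum _ fun i _ => hdc i] at hmono
  have hn : (1 : ℝ) ≤ n := by exact_mod_cast NeZero.one_le
  have hF0 : 0 ≤ ∫ x, F x := integral_nonneg fun x => by simp only [hF]; positivity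
  have : ∫ x : Rn n, ‖x‖ ^ (2 * j) * ‖v x‖ ^ 2 = ∫ x, F x := by
    simp only [hF, pow_mul]
  rw [this]
  nlinarith

lemma hardy_iterate [NeZero n] {m : ℕ} {u : Rn n → ℂ} (hu : ContDiff ℝ m u)
    (hc : HasCompactSupport u) {M : ℝ}
    (hM : ∀ l : List (Fin n), l.length = m →
      ∫ x : Rn n, ‖x‖ ^ (2 * m) * ‖listDeriv l u x‖ ^ 2 ≤ M) (k : ℕ) :
    ∀ l : List (Fin n), l.length + k = m →
      ∫ x : Rn n, ‖x‖ ^ (2 * l.length) * ‖listDeriv l u x‖ ^ 2 ≤ (4 * n) ^ k * M := by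
  induction k with
  | zero =>
    intro l hl
    have hl' : l.length = m := by omega
    rw [hl']; simpa using hM l hl'
  | succ k ih =>
    intro l hl
    have hd : ContDiff ℝ 1 (listDeriv l u) :=
      contDiff_listDeriv (k := 1) l (hu.of_le (by norm_cast; omega))
    refine (hardy_step l.length hd (hasCompactSupport_listDeriv l hc)).trans ?_
    have h1 : ∀ i ∈ (Finset.univ : Finset (Fin n)),
        ∫ x : Rn n, ‖x‖ ^ (2 * (l.length + 1)) * ‖partialDeriv i (listDeriv l u) x‖ ^ 2
          ≤ (4 * n) ^ k * M := fun i _ => by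
      have := ih (i :: l) (by simp; omega)
      simpa [listDeriv_cons] using this
    have h2 := Finset.sum_le_sum h1
    simp only [Finset.sum_const, Finset.card_univ, Fintype.card_fin, nsmul_eq_mul] at h2
    calc _ ≤ 4 * ((n : ℝ) * ((4 * n) ^ k * M)) := by gcongr
      _ = _ := by ring


/-! ### The space and its embedding -/

lemma measurable_weight (m : ℕ) (σ : ℝ) : Measurable (weight m σ : Rn n → ℝ) := by
  unfold weight
  have : Measurable fun x : Rn n => |Real.log ‖x‖| :=
    continuous_abs.measurable.comp (Real.measurable_log.comp measurable_norm)
  exact (measurable_norm.pow_const _).mul ((measurable_const.add this).pow_const _)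

lemma weight_nonneg (m : ℕ) (σ : ℝ) (x : Rn n) : 0 ≤ weight m σ x := by
  unfold weight; positivity

lemma exists_weight_le (m : ℕ) [NeZero m] (σ : ℝ) :
    ∃ C : ℝ, ∀ x : Rn n, x ∈ Metric.ball (0 : Rn n) 1 → weight m σ x ≤ C := by
  set s : ℝ := max (2 * σ) 1
  have hs : 0 < s := lt_max_of_lt_right one_pos
  have hm : (0 : ℝ) < m := by exact_mod_cast Nat.pos_of_ne_zero (NeZero.ne m)
  set r : ℝ := (2 * m : ℕ) / s with hr
  have hr0 : 0 < r := by simp only [hr]; push_cast; positivity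
  refine ⟨(1 + 1 / r) ^ s, fun x hx => ?_⟩
  have hx1 : ‖x‖ ≤ 1 := by simpa using (mem_ball_zero_iff.1 hx).le
  unfold weight
  rcases (norm_nonneg x).eq_or_lt with h0 | h0
  · rw [← h0, zero_pow (by have := NeZero.ne m; omega), zero_mul]
    positivity
  · have hL : 0 ≤ |Real.log ‖x‖| := abs_nonneg _
    have h1 : (1 + |Real.log ‖x‖|) ^ (2 * σ) ≤ (1 + |Real.log ‖x‖|) ^ s :=
      Real.rpow_le_rpow_of_exponent_le (by linarith) (le_max_left _ _)
    have h2 : ‖x‖ ^ (2 * m) = (‖x‖ ^ r) ^ s := by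
      rw [← Real.rpow_mul h0.le, hr, div_mul_cancel₀ _ hs.ne', Real.rpow_natCast]
    have h3 : ‖x‖ ^ r ≤ 1 := Real.rpow_le_one h0.le hx1 hr0.le
    have h4 : |Real.log ‖x‖| * ‖x‖ ^ r ≤ 1 / r := by
      have := (Real.abs_log_mul_self_rpow_lt ‖x‖ r h0 hx1 hr0).le
      rwa [abs_mul, abs_of_nonneg (Real.rpow_nonneg h0.le r)] at this
    calc ‖x‖ ^ (2 * m) * (1 + |Real.log ‖x‖|) ^ (2 * σ)
        ≤ (‖x‖ ^ r) ^ s * (1 + |Real.log ‖x‖|) ^ s := by rw [h2]; gcongr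
      _ = (‖x‖ ^ r * (1 + |Real.log ‖x‖|)) ^ s := by
          rw [Real.mul_rpow (by positivity) (by positivity)]
      _ ≤ (1 + 1 / r) ^ s := by
          refine Real.rpow_le_rpow (by positivity) ?_ hs.le
          nlinarith

/-- The function `b_{m,σ}^{1/2} D^α u`. -/
def weightedDeriv (m : ℕ) (σ : ℝ) (α : Fin n → ℕ) (u : Rn n → ℂ) : Rn n → ℂ :=
  fun x => (Real.sqrt (weight m σ x) : ℂ) * multiDeriv α u x

lemma memLp_testSpace {m : ℕ} (u : testSpace n m) : MemLp u.1 2 (ballMeasure n) := by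
  obtain ⟨hu, hc, -⟩ := u.2
  exact (hu.continuous.memLp_of_hasCompactSupport hc).restrict _

lemma memLp_weightedDeriv {m : ℕ} [NeZero m] (σ : ℝ) (α : MultiIndex n m) (u : testSpace n m) :
    MemLp (weightedDeriv m σ α.1 u.1) 2 (ballMeasure n) := by
  obtain ⟨hu, hc, -⟩ := u.2
  have hD : MemLp (multiDeriv α.1 u.1) 2 (ballMeasure n) :=
    ((contDiff_multiDeriv α hu).memLp_of_hasCompactSupport
      (hasCompactSupport_listDeriv _ hc)).restrict _
  obtain ⟨C, hC⟩ := exists_weight_le (n := n) m σ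
  refine hD.of_le_mul (c := Real.sqrt C) ?_ ?_
  · exact (Complex.measurable_ofReal.comp
      (measurable_weight m σ).sqrt).aestronglyMeasurable.mul hD.1
  · filter_upwards [ae_restrict_mem Metric.isOpen_ball.measurableSet] with x hx
    simp only [weightedDeriv, norm_mul, Complex.norm_real, Real.norm_eq_abs,
      abs_of_nonneg (Real.sqrt_nonneg _)]
    gcongr
    exact hC x hx

/-- The inclusion `C₀ᵐ(B) → L₂(B)`. -/
def testToL2 (n m : ℕ) : testSpace n m →ₗ[ℂ] L2B n where
  toFun u := (memLp_testSpace u).toLp u.1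
  map_add' u v := MemLp.toLp_add (memLp_testSpace u) (memLp_testSpace v)
  map_smul' c u := MemLp.toLp_const_smul c (memLp_testSpace u)

/-- The map `u ↦ (b_{m,σ}^{1/2} D^α u)_{|α| = m}` from `C₀ᵐ(B)` to the Hilbert sum of copies of
`L₂(B)`. The norm of the image of `u` is the norm `‖u | E^m_{2,σ}(B)‖`. -/
def testToGrad (n m : ℕ) [NeZero m] (σ : ℝ) :
    testSpace n m →ₗ[ℂ] PiLp 2 (fun _ : MultiIndex n m => L2B n) where
  toFun u := WithLp.toLp 2 fun α =>
    (memLp_weightedDeriv σ α u).toLp (weightedDeriv m σ α.1 u.1)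
  map_add' u v := by
    ext1 α
    have hα : ∑ i, α.1 i = m := (Finset.mem_piAntidiag.1 α.2).1
    have h : weightedDeriv m σ α.1 (u.1 + v.1) =
        weightedDeriv m σ α.1 u.1 + weightedDeriv m σ α.1 v.1 := by
      ext x
      simp only [weightedDeriv, multiDeriv, Pi.add_apply]
      rw [listDeriv_add _ (by rw [length_multi, hα]; exact u.2.1)
        (by rw [length_multi, hα]; exact v.2.1), Pi.add_apply, mul_add]
    refine Eq.trans ?_ (MemLp.toLp_add (memLp_weightedDeriv σ α u) (memLp_weightedDeriv σ α v))
    exact MemLp.toLp_congr (memLp_weightedDeriv σ α (u + v)) _ (Filter.EventuallyEq.of_eq h)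
  map_smul' c u := by
    ext1 α
    have hα : ∑ i, α.1 i = m := (Finset.mem_piAntidiag.1 α.2).1
    have h : weightedDeriv m σ α.1 (c • u.1) = c • weightedDeriv m σ α.1 u.1 := by
      ext x
      simp only [weightedDeriv, multiDeriv, Pi.smul_apply, smul_eq_mul]
      rw [listDeriv_smul _ c (by rw [length_multi, hα]; exact u.2.1), Pi.smul_apply, smul_eq_mul]
      ring
    refine Eq.trans ?_ (MemLp.toLp_const_smul c (memLp_weightedDeriv σ α u))
    exact MemLp.toLp_congr (memLp_weightedDeriv σ α (c • u)) _ (Filter.EventuallyEq.of_eq h)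

/-- The Hilbert space `E^m_{2,σ}(B)`: the completion of `C₀ᵐ(B)` in the norm
`(∫_B b_{m,σ} ∑_{|α|=m} |D^α u|²)^{1/2}`, realised as the closure of the space of all
`(b_{m,σ}^{1/2} D^α u)_{|α|=m}`, `u ∈ C₀ᵐ(B)`. -/
abbrev SobolevE (n m : ℕ) [NeZero m] (σ : ℝ) :=
  ↥(LinearMap.range (testToGrad n m σ)).topologicalClosure

/-- The inclusion `C₀ᵐ(B) → E^m_{2,σ}(B)`. -/
def testToE (n m : ℕ) [NeZero m] (σ : ℝ) : testSpace n m →ₗ[ℂ] SobolevE n m σ :=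
  (testToGrad n m σ).codRestrict _ fun u =>
    (LinearMap.range (testToGrad n m σ)).le_topologicalClosure (LinearMap.mem_range_self _ u)

lemma norm_toLp_sq {f : Rn n → ℂ} (hf : MemLp f 2 (ballMeasure n)) :
    ‖hf.toLp f‖ ^ 2 = ∫ x in Metric.ball (0 : Rn n) 1, ‖f x‖ ^ 2 := by
  have h := inner_self_eq_norm_sq_to_K (𝕜 := ℂ) (hf.toLp f)
  rw [L2.inner_def] at h
  have h2 : ∫ a, inner ℂ (hf.toLp f a) (hf.toLp f a) ∂(ballMeasure n) =
      ((∫ x in Metric.ball (0 : Rn n) 1, ‖f x‖ ^ 2 : ℝ) : ℂ) := by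
    rw [← integral_complex_ofReal]
    refine integral_congr_ae ?_
    filter_upwards [hf.coeFn_toLp] with x hx
    rw [hx, inner_self_eq_norm_sq_to_K]
    simp
  rw [h2] at h
  exact (Complex.ofReal_injective (by simpa using h)).symm

/-- The norm of `E^m_{2,σ}(B)` on `C₀ᵐ(B)`. -/
lemma norm_testToE_sq {m : ℕ} [NeZero m] (σ : ℝ) (u : testSpace n m) :
    ‖testToE n m σ u‖ ^ 2 = ∑ α : MultiIndex n m,
      ∫ x in Metric.ball (0 : Rn n) 1, weight m σ x * ‖multiDeriv α.1 u.1 x‖ ^ 2 := by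
  change ‖testToGrad n m σ u‖ ^ 2 = _
  rw [PiLp.norm_sq_eq_of_L2]
  refine Finset.sum_congr rfl fun α _ => ?_
  refine (norm_toLp_sq (memLp_weightedDeriv σ α u)).trans ?_
  refine integral_congr_ae (Filter.Eventually.of_forall fun x => ?_)
  simp [weightedDeriv, mul_pow, Real.sq_sqrt (weight_nonneg m σ x)]

lemma denseRange_testToE (n m : ℕ) [NeZero m] (σ : ℝ) : DenseRange (testToE n m σ) := by
  intro x
  rw [closure_subtype]
  have h : (Subtype.val '' Set.range (testToE n m σ)) =
      (LinearMap.range (testToGrad n m σ) : Set _) := by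
    ext y
    constructor
    · rintro ⟨_, ⟨u, rfl⟩, rfl⟩
      exact ⟨u, rfl⟩
    · rintro ⟨u, rfl⟩
      exact ⟨_, ⟨u, rfl⟩, rfl⟩
  rw [h]
  exact x.2

lemma setIntegral_eq {f : Rn n → ℝ} (hf : ∀ x ∉ Metric.ball (0 : Rn n) 1, f x = 0) :
    ∫ x in Metric.ball (0 : Rn n) 1, f x = ∫ x, f x :=
  setIntegral_eq_integral_of_forall_compl_eq_zero hf

/-- Hardy's inequality: the inclusion `C₀ᵐ(B) → L₂(B)` is bounded in the norm of
`E^m_{2,σ}(B)`. -/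
lemma exists_norm_le (n m : ℕ) [NeZero n] [NeZero m] {σ : ℝ} (hσ : 0 ≤ σ) :
    ∃ C : ℝ, ∀ u : testSpace n m, ‖testToL2 n m u‖ ≤ C * ‖testToE n m σ u‖ := by
  refine ⟨Real.sqrt ((4 * n) ^ m), fun u => ?_⟩
  obtain ⟨hu, hc, hs⟩ := u.2
  have hw : ∀ x : Rn n, ‖x‖ ^ (2 * m) ≤ weight m σ x := fun x => by
    unfold weight
    exact le_mul_of_one_le_right (by positivity)
      (Real.one_le_rpow (by linarith [abs_nonneg (Real.log ‖x‖)]) (by positivity))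
  have hM : ∀ l : List (Fin n), l.length = m →
      ∫ x : Rn n, ‖x‖ ^ (2 * m) * ‖listDeriv l u.1 x‖ ^ 2 ≤ ‖testToE n m σ u‖ ^ 2 := by
    intro l hl
    obtain ⟨α, hα⟩ := exists_multiDeriv_eq l hl
    rw [hα u.1 hu, norm_testToE_sq]
    have h0 : ∀ β : MultiIndex n m, 0 ≤
        ∫ x in Metric.ball (0 : Rn n) 1, weight m σ x * ‖multiDeriv β.1 u.1 x‖ ^ 2 :=
      fun β => integral_nonneg fun x => mul_nonneg (weight_nonneg m σ x) (by positivity)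
    refine le_trans ?_ (Finset.single_le_sum (fun β _ => h0 β) (Finset.mem_univ α))
    have hz : ∀ x ∉ Metric.ball (0 : Rn n) 1, multiDeriv α.1 u.1 x = 0 := fun x hx =>
      image_eq_zero_of_notMem_tsupport fun h => hx (hs (tsupport_listDeriv _ _ h))
    have hcont := contDiff_multiDeriv α hu
    have hcs : HasCompactSupport (multiDeriv α.1 u.1) := hasCompactSupport_listDeriv _ hc
    rw [← setIntegral_eq (fun x hx => by simp [hz x hx])]
    refine integral_mono ?_ ?_ fun x => ?_
    · refine (Continuous.integrable_of_hasCompactSupport (by fun_prop) ?_).restrict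
      exact (hcs.comp_left (g := fun z : ℂ => ‖z‖ ^ 2) (by simp)).mul_left
    · have h := (memLp_weightedDeriv σ α u).integrable_norm_pow (by simp)
      refine h.congr (Filter.Eventually.of_forall fun x => ?_)
      simp [weightedDeriv, mul_pow, Real.sq_sqrt (weight_nonneg m σ x)]
    · exact mul_le_mul_of_nonneg_right (hw x) (by positivity)
  have h1 := hardy_iterate hu hc hM m [] (by simp)
  have h2 : ‖testToL2 n m u‖ ^ 2 ≤ (4 * n) ^ m * ‖testToE n m σ u‖ ^ 2 := by
    refine le_trans (le_of_eq ?_) h1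
    refine (norm_toLp_sq (memLp_testSpace u)).trans ?_
    rw [setIntegral_eq]
    · simp [listDeriv]
    · intro x hx
      simp [image_eq_zero_of_notMem_tsupport fun h => hx (hs h)]
  rw [← Real.sqrt_sq (norm_nonneg (testToE n m σ u)), ← Real.sqrt_mul (by positivity)]
  exact Real.le_sqrt_of_sq_le h2

/-- The embedding `id : E^m_{2,σ}(B) → L₂(B)`: the continuous extension of the inclusion
`C₀ᵐ(B) → L₂(B)`. -/
def embedding (n m : ℕ) [NeZero m] (σ : ℝ) : SobolevE n m σ →L[ℂ] L2B n :=
  (testToL2 n m).extendOfNorm (testToE n m σ)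

lemma embedding_testToE {m : ℕ} [NeZero n] [NeZero m] {σ : ℝ} (hσ : 0 ≤ σ) (u : testSpace n m) :
    embedding n m σ (testToE n m σ u) = testToL2 n m u :=
  LinearMap.extendOfNorm_eq (denseRange_testToE n m σ) (exists_norm_le n m hσ) u

/-- The quadratic form relation generating `A^m_σ`: the pairs `(f, h)` in `L₂(B)` such that
`f = id u` for some `u ∈ E^m_{2,σ}(B)` with `(h, id v)_{L₂(B)} = (u, v)_{E^m_{2,σ}(B)}` for all
`v ∈ E^m_{2,σ}(B)`. -/
def formGraph (n m : ℕ) [NeZero m] (σ : ℝ) : Submodule ℂ (L2B n × L2B n) where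
  carrier := {p | ∃ u : SobolevE n m σ, embedding n m σ u = p.1 ∧
    ∀ v : SobolevE n m σ, inner ℂ p.2 (embedding n m σ v) = inner ℂ u v}
  add_mem' := by
    rintro p q ⟨u, hu, hu'⟩ ⟨v, hv, hv'⟩
    exact ⟨u + v, by simp [hu, hv], fun w => by simp only [Prod.snd_add, inner_add_left, hu', hv']⟩
  zero_mem' := ⟨0, by simp, by simp⟩
  smul_mem' := by
    rintro c p ⟨u, hu, hu'⟩
    exact ⟨c • u, by simp [hu], fun w => by
      rw [Prod.smul_snd, inner_smul_left, hu']
      exact (inner_smul_left u w c).symm⟩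


/-- Integration by parts. -/
lemma exists_adjoint_listDeriv (l : List (Fin n)) : ∀ φ : Rn n → ℝ, ContDiff ℝ ∞ φ →
    HasCompactSupport φ → ∃ ψ : Rn n → ℝ, ContDiff ℝ ∞ ψ ∧ HasCompactSupport ψ ∧
      ∀ u : Rn n → ℂ, ContDiff ℝ l.length u → ∫ x, φ x • listDeriv l u x = ∫ x, ψ x • u x := by
  induction l with
  | nil => exact fun φ h1 h2 => ⟨φ, h1, h2, fun u _ => rfl⟩
  | cons i l ih =>
    intro φ h1 h2
    set φ' : Rn n → ℝ := fun x => -fderiv ℝ φ x (EuclideanSpace.single i 1) with hφ'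
    have hd : ContDiff ℝ ∞ φ' :=
      ((h1.fderiv_right (m := ∞) (by simp)).clm_apply contDiff_const).neg
    have hc : HasCompactSupport φ' := by
      refine (h2.fderiv (𝕜 := ℝ)).of_isClosed_subset isClosed_closure (closure_mono ?_)
      intro x hx h
      apply hx
      simp [hφ', h]
    obtain ⟨ψ, hψ1, hψ2, hψ⟩ := ih φ' hd hc
    refine ⟨ψ, hψ1, hψ2, fun u hu => ?_⟩
    simp only [List.length_cons] at hu
    rw [← hψ u (hu.of_le (by norm_cast; omega))]
    have hv : ContDiff ℝ 1 (listDeriv l u) := contDiff_listDeriv (k := 1) l hu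
    have hvc := hv.continuous
    have hvd : Continuous (fderiv ℝ (listDeriv l u)) := hv.continuous_fderiv (by simp)
    have hφc := h1.continuous
    have key := integral_smul_fderiv_eq_neg_fderiv_smul_of_integrable
      (μ := (volume : Measure (Rn n))) (f := φ) (g := listDeriv l u)
      (v := EuclideanSpace.single i (1 : ℝ)) ?_ ?_ ?_ ?_ ?_
    · rw [listDeriv_cons]
      refine key.trans ?_
      rw [← integral_neg]
      simp only [hφ', neg_smul]
    · have := (Continuous.integrable_of_hasCompactSupport (μ := (volume : Measure (Rn n)))
        (f := fun x => φ' x • listDeriv l u x) (by have := hd.continuous; fun_prop)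
        hc.smul_right).neg
      refine this.congr (Filter.Eventually.of_forall fun x => ?_)
      simp [hφ']
    · exact Continuous.integrable_of_hasCompactSupport (by fun_prop) h2.smul_right
    · exact Continuous.integrable_of_hasCompactSupport (by fun_prop) h2.smul_right
    · exact fun x _ => h1.differentiable (by simp) x
    · exact fun x _ => hv.differentiable (by simp) x

lemma continuousOn_sqrt_weight (m : ℕ) (σ : ℝ) :
    ContinuousOn (fun x : Rn n => Real.sqrt (weight m σ x)) {0}ᶜ := by
  unfold weight
  refine ContinuousOn.sqrt (ContinuousOn.mul (by fun_prop) (ContinuousOn.rpow_const ?_ ?_))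
  · refine continuousOn_const.add (ContinuousOn.abs (ContinuousOn.log (by fun_prop) ?_))
    intro x hx
    simpa using hx
  · intro x _
    left
    positivity

lemma sqrt_weight_ne_zero (m : ℕ) (σ : ℝ) {x : Rn n} (hx : x ≠ 0) :
    Real.sqrt (weight m σ x) ≠ 0 := by
  have : 0 < weight m σ x := by
    unfold weight
    have := norm_pos_iff.2 hx
    positivity
  exact (Real.sqrt_pos.2 this).ne'

lemma inner_toLp_ofReal {φ : Rn n → ℝ} (hφ : MemLp (fun x => (φ x : ℂ)) 2 (ballMeasure n))
    (f : L2B n) : inner ℂ (hφ.toLp _) f = ∫ x, φ x • f x ∂(ballMeasure n) := by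
  rw [L2.inner_def]
  refine integral_congr_ae ?_
  filter_upwards [hφ.coeFn_toLp] with x hx
  rw [hx, RCLike.inner_apply]
  simp [mul_comm]

/-- The embedding `id : E^m_{2,σ}(B) → L₂(B)` is injective. -/
lemma embedding_injective (n m : ℕ) [NeZero n] [NeZero m] {σ : ℝ} (hσ : 0 ≤ σ) :
    Function.Injective (embedding n m σ) := by
  rw [injective_iff_map_eq_zero]
  intro X hX
  have key : ∀ (α : MultiIndex n m), ∀ᵐ x ∂(ballMeasure n),
      x ∈ ({0}ᶜ : Set (Rn n)) ∩ Metric.ball 0 1 →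
        (Real.sqrt (weight m σ x))⁻¹ • (X.1 α : Rn n → ℂ) x = 0 := by
    intro α
    have hα : ∑ i, α.1 i = m := (Finset.mem_piAntidiag.1 α.2).1
    have hU : IsOpen (({0}ᶜ : Set (Rn n)) ∩ Metric.ball 0 1) :=
      isOpen_compl_singleton.inter Metric.isOpen_ball
    have hcw : ContinuousOn (fun x : Rn n => (Real.sqrt (weight m σ x))⁻¹) {0}ᶜ :=
      (continuousOn_sqrt_weight m σ).inv₀ fun x hx => sqrt_weight_ne_zero m σ hx
    refine hU.ae_eq_zero_of_integral_contDiff_smul_eq_zero ?_ ?_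
    · have hint : Integrable (X.1 α : Rn n → ℂ) (ballMeasure n) :=
        (Lp.memLp (X.1 α)).integrable (by norm_num)
      exact ((hint.locallyIntegrable.locallyIntegrableOn _).continuousOn_smul hU.isLocallyClosed
        (hcw.mono Set.inter_subset_left))
    · intro φ hφ hφc hφs
      obtain ⟨ψ, hψ, hψc, hψu⟩ := exists_adjoint_listDeriv
        ((List.finRange n).flatMap fun i => List.replicate (α.1 i) i) φ hφ hφc
      have hpc : Continuous fun x => φ x * (Real.sqrt (weight m σ x))⁻¹ := by
        refine continuous_of_tsupport fun x hx => ?_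
        have hx0 : x ∈ ({0}ᶜ : Set (Rn n)) := (hφs (tsupport_mul_subset_left hx)).1
        exact hφ.continuous.continuousAt.mul
          (hcw.continuousAt (isOpen_compl_singleton.mem_nhds hx0))
      have hp : MemLp (fun x => ((φ x * (Real.sqrt (weight m σ x))⁻¹ : ℝ) : ℂ)) 2
          (ballMeasure n) :=
        ((Complex.continuous_ofReal.comp hpc).memLp_of_hasCompactSupport
          ((hφc.mul_right (f' := fun x => (Real.sqrt (weight m σ x))⁻¹)).comp_left
            (g := Complex.ofReal) (by simp))).restrict _
      have hq : MemLp (fun x => (ψ x : ℂ)) 2 (ballMeasure n) :=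
        ((Complex.continuous_ofReal.comp hψ.continuous).memLp_of_hasCompactSupport
          (hψc.comp_left (g := Complex.ofReal) (by simp))).restrict _
      have hid : ∀ Y : SobolevE n m σ,
          inner ℂ (hp.toLp _) (Y.1 α) = inner ℂ (hq.toLp _) (embedding n m σ Y) := by
        refine (denseRange_testToE n m σ).induction ?_ (isClosed_eq ?_ ?_)
        · rintro _ ⟨u, rfl⟩
          obtain ⟨hu, hc, hs⟩ := u.2
          rw [embedding_testToE hσ, inner_toLp_ofReal hp, inner_toLp_ofReal hq]
          have h1 : ∫ x, (φ x * (Real.sqrt (weight m σ x))⁻¹) •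
              ((testToE n m σ u).1 α : Rn n → ℂ) x ∂(ballMeasure n) =
              ∫ x in Metric.ball (0 : Rn n) 1, φ x • multiDeriv α.1 u.1 x := by
            refine integral_congr_ae ?_
            filter_upwards [(memLp_weightedDeriv σ α u).coeFn_toLp] with x hx
            have hx' : ((testToE n m σ u).1 α : Rn n → ℂ) x = weightedDeriv m σ α.1 u.1 x := hx
            rw [hx']
            by_cases hx0 : x = 0
            · have : φ x = 0 := image_eq_zero_of_notMem_tsupport fun h => (hφs h).1 hx0
              simp [this]
            · have hw : (Real.sqrt (weight m σ x) : ℂ) ≠ 0 := by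
                exact_mod_cast sqrt_weight_ne_zero m σ hx0
              simp only [weightedDeriv, Complex.real_smul, Complex.ofReal_mul, Complex.ofReal_inv]
              field_simp
          have h2 : ∫ x, ψ x • (testToL2 n m u : Rn n → ℂ) x ∂(ballMeasure n) =
              ∫ x in Metric.ball (0 : Rn n) 1, ψ x • u.1 x := by
            refine integral_congr_ae ?_
            filter_upwards [(memLp_testSpace u).coeFn_toLp] with x hx
            have hx' : (testToL2 n m u : Rn n → ℂ) x = u.1 x := hx
            rw [hx']
          rw [h1, h2, setIntegral_eq_integral_of_forall_compl_eq_zero,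
            setIntegral_eq_integral_of_forall_compl_eq_zero]
          · exact hψu u.1 (by rw [length_multi, hα]; exact hu)
          · intro x hx
            simp [image_eq_zero_of_notMem_tsupport fun h => hx (hs h)]
          · intro x hx
            have : φ x = 0 := image_eq_zero_of_notMem_tsupport fun h => hx (hφs h).2
            simp [this]
        · exact continuous_const.inner ((PiLp.continuous_apply 2 _ α).comp continuous_subtype_val)
        · exact continuous_const.inner (embedding n m σ).continuous
      have h3 := hid X
      rw [hX, inner_zero_right, inner_toLp_ofReal hp] at h3
      simpa [smul_smul, mul_assoc] using h3
  have hα0 : ∀ α : MultiIndex n m, X.1 α = 0 := by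
    intro α
    refine Lp.ext ?_
    have hne : ∀ᵐ x ∂(ballMeasure n), x ≠ 0 := by
      have : Nontrivial (Rn n) := by
        have : Nonempty (Fin n) := ⟨0⟩
        infer_instance
      exact Measure.ae_ne _ _
    filter_upwards [key α, hne, ae_restrict_mem Metric.isOpen_ball.measurableSet,
      Lp.coeFn_zero ℂ 2 (ballMeasure n)] with x h1 h2 h3 h4
    rw [h4]
    exact (smul_eq_zero.1 (h1 ⟨h2, h3⟩)).resolve_left (inv_ne_zero (sqrt_weight_ne_zero m σ h2))
  ext1
  ext1 α
  exact hα0 α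

/-- The form relation is single-valued. -/
lemma formGraph_single_valued (n m : ℕ) [NeZero n] [NeZero m] {σ : ℝ} (hσ : 0 ≤ σ)
    (p : L2B n × L2B n) (hp : p ∈ formGraph n m σ) (h0 : p.1 = 0) : p.2 = 0 := by
  obtain ⟨u, hu, huv⟩ := hp
  have hu0 : u = 0 := embedding_injective n m hσ (by rw [hu, h0, map_zero])
  subst hu0
  refine Lp.ext ?_
  have key : ∀ᵐ x ∂(ballMeasure n), x ∈ Metric.ball (0 : Rn n) 1 → (p.2 : Rn n → ℂ) x = 0 := by
    refine Metric.isOpen_ball.ae_eq_zero_of_integral_contDiff_smul_eq_zero ?_ ?_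
    · exact ((Lp.memLp p.2).integrable (by norm_num)).locallyIntegrable.locallyIntegrableOn _
    · intro φ hφ hφc hφs
      have hw : (fun x => (φ x : ℂ)) ∈ testSpace n m := by
        refine ⟨?_, hφc.comp_left (g := Complex.ofReal) (by simp), ?_⟩
        · exact (Complex.ofRealCLM.contDiff.comp hφ).of_le (by exact_mod_cast le_top)
        · refine (closure_mono ?_).trans hφs
          intro x hx h
          exact hx (by simp [h])
      have h1 := huv (testToE n m σ ⟨_, hw⟩)
      rw [embedding_testToE hσ, inner_zero_left, inner_eq_zero_symm] at h1
      rw [← inner_toLp_ofReal (memLp_testSpace ⟨_, hw⟩) p.2]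
      exact h1
  filter_upwards [key, ae_restrict_mem Metric.isOpen_ball.measurableSet,
    Lp.coeFn_zero ℂ 2 (ballMeasure n)] with x h1 h2 h3
  rw [h3, h1 h2]
  rfl


/-- The self-adjoint operator `A^m_σ f = (-1)^m ∑_{|α|=m} D^α (b_{m,σ} D^α f)` in `L₂(B)`, as the
operator generated by the inner product of `E^m_{2,σ}(B)`: `f` is in its domain and `A f = h` if and
only if `f ∈ E^m_{2,σ}(B)` and `(h, g)_{L₂(B)} = (f, g)_{E^m_{2,σ}(B)}` for all
`g ∈ E^m_{2,σ}(B)`. -/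
def degenerateOp (n m : ℕ) [NeZero m] (σ : ℝ) : L2B n →ₗ.[ℂ] L2B n :=
  (formGraph n m σ).toLinearPMap

lemma degenerateOp_graph (n m : ℕ) [NeZero n] [NeZero m] {σ : ℝ} (hσ : 0 ≤ σ) :
    (degenerateOp n m σ).graph = formGraph n m σ :=
  Submodule.toLinearPMap_graph_eq _ (formGraph_single_valued n m hσ)

/-! ### Approximation numbers and bracketing numbers -/

section Operators

variable {X Y : Type*} [NormedAddCommGroup X] [NormedSpace ℂ X] [NormedAddCommGroup Y]
  [NormedSpace ℂ Y]

/-- The `k`-th approximation number `a_k(T) = inf {‖T - S‖ : rank S < k}`, `k ≥ 1`. -/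
def approxNumber (T : X →L[ℂ] Y) (k : ℕ) : ℝ :=
  sInf {r : ℝ | ∃ S : X →L[ℂ] Y, LinearMap.rank (S : X →ₗ[ℂ] Y) < (k : Cardinal) ∧ r = ‖T - S‖}

/-- `ν₀(ε) = max {k ∈ ℕ, k ≥ 1 : a_k(T) ≥ ε}`, and `0` if there is no such `k`; the value is `⊤` if
and only if there are arbitrarily large such `k`. -/
def nuZero (T : X →L[ℂ] Y) (ε : ℝ) : ℕ∞ :=
  ⨆ k ∈ {k : ℕ | 1 ≤ k ∧ ε ≤ approxNumber T k}, (k : ℕ∞)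

/-- `α(S) = sup_{u ∈ S \ {0}} ‖u‖ / ‖T u‖`, in `[0, ∞]`. -/
def alphaNumber (T : X →L[ℂ] Y) (S : Submodule ℂ X) : ℝ≥0∞ :=
  ⨆ u ∈ {u : X | u ∈ S ∧ u ≠ 0}, ‖u‖ₑ / ‖T u‖ₑ

/-- `μ₀(ε) = max {dim S : α(S) ≤ 1 / ε}` over the finite-dimensional subspaces `S`; the value is `⊤`
if and only if these dimensions are unbounded. -/
def muZero (T : X →L[ℂ] Y) (ε : ℝ) : ℕ∞ :=
  ⨆ S ∈ {S : Submodule ℂ X | FiniteDimensional ℂ S ∧ alphaNumber T S ≤ ENNReal.ofReal (1 / ε)},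
    (Module.finrank ℂ S : ℕ∞)

end Operators

/-! ### Spectral theory of unbounded operators -/

section Spectrum

variable {H : Type*} [NormedAddCommGroup H] [InnerProductSpace ℂ H]

/-- The resolvent set of an unbounded operator: `A - z` is a bijection from the domain of `A` onto
the space, with bounded inverse `R`. -/
def resolventSet (A : H →ₗ.[ℂ] H) : Set ℂ :=
  {z | ∃ R : H →L[ℂ] H, (∀ h, ∃ hd : R h ∈ A.domain, A ⟨R h, hd⟩ - z • R h = h) ∧
    ∀ f : A.domain, R (A f - z • (f : H)) = f}

/-- The spectrum of an unbounded operator. -/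
def spectrumSet (A : H →ₗ.[ℂ] H) : Set ℂ := (resolventSet A)ᶜ

/-- The geometric eigenspace `ker (A - z)`. -/
def eigenspace (A : H →ₗ.[ℂ] H) (z : ℂ) : Submodule ℂ H :=
  (LinearMap.ker (A.toFun - z • A.domain.subtype)).map A.domain.subtype

/-- Pure point spectrum: the spectrum consists of isolated eigenvalues of finite multiplicity, and
the eigenvectors span a dense subspace. -/
structure HasPurePointSpectrum (A : H →ₗ.[ℂ] H) : Prop where
  eigenvalue : ∀ z ∈ spectrumSet A, eigenspace A z ≠ ⊥
  finite_multiplicity : ∀ z ∈ spectrumSet A, FiniteDimensional ℂ (eigenspace A z)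
  isolated : ∀ z ∈ spectrumSet A, ∃ r > 0, ∀ w ∈ spectrumSet A, dist w z < r → w = z
  complete : (⨆ z : ℂ, eigenspace A z).topologicalClosure = ⊤

/-- `lam` enumerates all eigenvalues of `A` in increasing order, each of them repeated according to
its geometric multiplicity. -/
structure IsEigenvalueSequence (A : H →ₗ.[ℂ] H) (lam : ℕ → ℝ) : Prop where
  monotone : Monotone lam
  multiplicity : ∀ z : ℂ, {k : ℕ | (lam k : ℂ) = z}.encard =
    Cardinal.toENat (Module.rank ℂ (eigenspace A z))

/-- `A` is positive definite: `(A f, f) ≥ c ‖f‖²` on the domain of `A`, for some `c > 0`. -/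
def IsPositiveDefinite (A : H →ₗ.[ℂ] H) : Prop :=
  ∃ c : ℝ, 0 < c ∧ ∀ f : A.domain, c * ‖(f : H)‖ ^ 2 ≤ (inner ℂ (A f) (f : H)).re

end Spectrum

end DegSobolev

end

/-! Write `T` for `embedding n m σ`. Two facts give everything: `T` is compact, and the form
relation defining `degenerateOp` is the inverse of `T T†`.

Abstract part. Since (h, T v) = (T† h, v), a pair (f, h) lies in the form relation exactly when f =
T T† h (`mem_formGraph_iff`). That relation is single-valued, so `T T†` is injective, and so is
`T†`. Hence `T T†` is compact and symmetric with strictly positive quadratic form. It has an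
orthonormal eigenbasis b_k with eigenvalues s_k² decreasing to 0, and the vectors x_k = s_k⁻¹ T† b_k
complete a singular system (`exists_isSingularSystem`). Given ε, let N be the number of k with s_k ≥
ε. On the span of x_0, …, x_{N-1} one has ‖T u‖ ≥ ε ‖u‖, and on its orthogonal complement ‖T u‖ ≤
s_N ‖u‖ with s_N < ε. A dimension count turns this into a_{k+1} = s_k and ν₀ = N (`nuZero_eq`), and
into μ₀ = N (`muZero_eq`). The eigenvalues of A = (T T†)⁻¹ are s_k⁻², and s_k ≥ ε means s_k⁻² ≤ ε⁻².
The spectral statements are the Fredholm alternative for `T T†`, read through the inverse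
(`hasPurePointSpectrum_of_graph`).

Compactness. The power |x|^{2m} alone gives boundedness through Hardy's inequality; the logarithm
with σ > 0 prevents concentration at the origin. Hardy's inequality survives an extra factor g that
decays slowly along rays (`weighted_hardy_step`). Applied to the regularized logarithms `logWeight σ
s`, it has constants independent of s, while these weights exceed any bound near 0 for small s. Thus
the L₂ mass near 0 is uniformly small (`exists_integral_ball_le`). Away from 0, Hardy's inequality
controls |x|²|∇u|², so u is L₂-close to its averages over small balls
(`lintegral_sub_average_sq_le`). Cut-off averaging is a compact operator, because its kernel takes
values in a compact set. So `T` is a norm limit of compact operators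
(`isCompactOperator_embedding`). -/

noncomputable section

namespace DegSobolev

/-! ### Compact positive operators -/

/-- A positive function on an infinite type with finite superlevel sets can be enumerated in
decreasing order. -/
lemma exists_equiv_nat_antitone {ι : Type*} [Infinite ι] (f : ι → ℝ) (hf : ∀ i, 0 < f i)
    (hfin : ∀ c : ℝ, 0 < c → {i | c ≤ f i}.Finite) : ∃ e : ℕ ≃ ι, Antitone (f ∘ e) := by
  classical
  -- The second coordinate only breaks ties between equal values of `f`; any injection into a linear
  -- order would do.
  let g : ι ↪ Cardinal := embeddingToCardinal
  let φ : ι → ℝ ×ₗ Cardinal := fun i => toLex (-f i, g i)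
  have hφ : Function.Injective φ := fun i j h => by
    have : (-f i, g i) = (-f j, g j) := toLex.injective h
    exact g.injective (Prod.ext_iff.1 this).2
  let _ : LinearOrder ι := LinearOrder.lift' φ hφ
  have hle : ∀ i j : ι, i ≤ j → f j ≤ f i := by
    intro i j h
    have h' : φ i ≤ φ j := h
    rw [Prod.Lex.toLex_le_toLex] at h'
    rcases h' with h' | h'
    · linarith
    · linarith [h'.1]
  have hIic : ∀ i : ι, (Set.Iic i).Finite := fun i =>
    (hfin (f i) (hf i)).subset fun j hj => hle j i hj
  let _ : LocallyFiniteOrder ι := LocallyFiniteOrder.ofFiniteIcc fun a b =>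
    (hIic b).subset fun x hx => hx.2
  obtain ⟨i₀⟩ : Nonempty ι := inferInstance
  -- A minimal element of one finite initial segment is the least element overall. A locally finite
  -- linear order with a least and no greatest element is isomorphic to ℕ.
  obtain ⟨m, hm, hmin⟩ := (hIic i₀).exists_minimal ⟨i₀, le_refl i₀⟩
  let _ : OrderBot ι :=
    { bot := m
      bot_le := fun a => by
        rcases le_total a m with h | h
        · exact hmin (le_trans h hm) h
        · exact h }
  have : NoMaxOrder ι := ⟨fun a => by
    by_contra! h
    exact Set.infinite_univ ((hIic a).subset fun x _ => h x)⟩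
  let _ : SuccOrder ι := LinearLocallyFiniteOrder.succOrder ι
  let _ : PredOrder ι := LinearLocallyFiniteOrder.predOrder ι
  let e : ι ≃o ℕ := orderIsoNatOfLinearSuccPredArch
  exact ⟨e.symm.toEquiv, fun a b hab => hle _ _ (e.symm.monotone hab)⟩

section Diagonalization

variable {H : Type*} [NormedAddCommGroup H] [InnerProductSpace ℂ H]

/-- A compact operator has only finitely many orthonormal eigenvectors with eigenvalues bounded
away from zero. -/
lemma finite_le_of_isCompactOperator {K : H →L[ℂ] H} (hK : IsCompactOperator K) {ι : Type*}
    {v : ι → H} (hv : Orthonormal ℂ v) {f : ι → ℝ} (hvK : ∀ i, K (v i) = (f i : ℂ) • v i)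
    {c : ℝ} (hc : 0 < c) : {i | c ≤ f i}.Finite := by
  by_contra hinf
  let e := Set.Infinite.natEmbedding _ hinf
  obtain ⟨C, hC, hC'⟩ := hK.image_closedBall_subset_compact 1
  obtain ⟨y, -, ψ, hψ, hlim⟩ := hC.tendsto_subseq
    (x := fun k => K (v (e k))) fun k => hC' ⟨v (e k), by simp [hv.1], rfl⟩
  obtain ⟨N, hN⟩ := Metric.cauchySeq_iff'.1 hlim.cauchySeq c hc
  have h1 := hN (N + 1) (Nat.le_succ N)
  have hne : (e (ψ (N + 1)) : ι) ≠ e (ψ N) := fun h => by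
    have := hψ.injective (e.injective (Subtype.ext h))
    omega
  simp only [Function.comp_apply, hvK, dist_eq_norm] at h1
  have h2 := hv.2 hne
  -- By Pythagoras two of the images are at distance at least `c`, which contradicts the Cauchy
  -- property of the subsequence.
  have h3 : ‖(f (e (ψ (N + 1))) : ℂ) • v (e (ψ (N + 1))) - (f (e (ψ N)) : ℂ) • v (e (ψ N))‖ ^ 2 =
      f (e (ψ (N + 1))) ^ 2 + f (e (ψ N)) ^ 2 := by
    rw [@norm_sub_sq ℂ, inner_smul_left, inner_smul_right, h2]
    simp [norm_smul, hv.1]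
  have h4 : c ≤ f (e (ψ (N + 1))) := (e (ψ (N + 1))).2
  nlinarith [norm_nonneg ((f (e (ψ (N + 1))) : ℂ) • v (e (ψ (N + 1))) -
    (f (e (ψ N)) : ℂ) • v (e (ψ N))), sq_nonneg (f (e (ψ N)))]

/-- Diagonalization of a compact positive operator with trivial kernel on an infinite-dimensional
Hilbert space. -/
theorem exists_hilbertBasis_eigenvectors [CompleteSpace H] (hdim : ¬ FiniteDimensional ℂ H) {K : H →L[ℂ] H}
    (hK : IsCompactOperator K) (hsymm : K.IsSymmetric)
    (hpos : ∀ y ≠ 0, 0 < (inner ℂ y (K y)).re) :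
    ∃ (b : HilbertBasis ℕ ℂ H) (ev : ℕ → ℝ), Antitone ev ∧ (∀ k, 0 < ev k) ∧
      Filter.Tendsto ev Filter.atTop (nhds 0) ∧ ∀ k, K (b k) = (ev k : ℂ) • b k := by
  have hev : ∀ (z : ℂ) (v : H), K v = z • v → v ≠ 0 → z = (z.re : ℂ) ∧ 0 < z.re := by
    intro z v hv h0
    have h1 := hsymm.conj_eigenvalue_eq_self
      (Module.End.hasEigenvalue_of_hasEigenvector ⟨Module.End.mem_eigenspace_iff.2 hv, h0⟩)
    have h2 : z = (z.re : ℂ) := (Complex.conj_eq_iff_re.1 h1).symm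
    refine ⟨h2, ?_⟩
    have h3 := hpos v h0
    rw [hv, inner_smul_right, inner_self_eq_norm_sq_to_K, h2] at h3
    have h4 : ((z.re : ℂ) * ((‖v‖ : ℝ) : ℂ) ^ 2).re = z.re * ‖v‖ ^ 2 := by norm_cast
    have h5 : 0 < z.re * ‖v‖ ^ 2 := h4 ▸ h3
    exact pos_of_mul_pos_left h5 (by positivity)
  have hfd : ∀ z : ℂ, FiniteDimensional ℂ (Module.End.eigenspace (K : H →ₗ[ℂ] H) z) := by
    intro z
    by_cases hz : z = 0
    · have : Module.End.eigenspace (K : H →ₗ[ℂ] H) z = ⊥ := by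
        rw [Submodule.eq_bot_iff]
        intro v hv
        by_contra h0
        have := (hev z v (Module.End.mem_eigenspace_iff.1 hv) h0).2
        simp [hz] at this
      rw [this]
      infer_instance
    · exact ContinuousLinearMap.finite_dimensional_eigenspace hK z hz
  let E : ℂ → Submodule ℂ H := fun z => Module.End.eigenspace (K : H →ₗ[ℂ] H) z
  -- All complex `z` are admitted; a non-eigenvalue contributes the empty fibre `Fin 0`.
  let ι := Σ z : ℂ, Fin (Module.finrank ℂ (E z))
  let v : ι → H := fun i => (stdOrthonormalBasis ℂ (E i.1) i.2 : H)
  have hv : Orthonormal ℂ v := hsymm.orthogonalFamily_eigenspaces.orthonormal_sigma_orthonormal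
    (v_family := fun z i => stdOrthonormalBasis ℂ (E z) i)
    fun z => (stdOrthonormalBasis ℂ (E z)).orthonormal
  have hvK' : ∀ i, K (v i) = i.1 • v i := fun i =>
    Module.End.mem_eigenspace_iff.1 (stdOrthonormalBasis ℂ (E i.1) i.2).2
  have hv0 : ∀ i, v i ≠ 0 := fun i => hv.ne_zero i
  have hvK : ∀ i, K (v i) = (i.1.re : ℂ) • v i := fun i => by
    rw [← (hev i.1 (v i) (hvK' i) (hv0 i)).1]; exact hvK' i
  have hf : ∀ i : ι, 0 < i.1.re := fun i => (hev i.1 (v i) (hvK' i) (hv0 i)).2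
  have hspan : (Submodule.span ℂ (Set.range v))ᗮ = ⊥ := by
    rw [eq_bot_iff, ← ContinuousLinearMap.orthogonalComplement_iSup_eigenspaces_eq_bot hK hsymm]
    refine Submodule.orthogonal_le (iSup_le fun z => ?_)
    intro y hy
    have h1 := (stdOrthonormalBasis ℂ (E z)).sum_repr ⟨y, hy⟩
    have h2 : y = ∑ i, (stdOrthonormalBasis ℂ (E z)).repr ⟨y, hy⟩ i • v ⟨z, i⟩ := by
      have := congrArg (Subtype.val) h1
      rw [Submodule.coe_sum] at this
      exact this.symm
    rw [h2]
    exact Submodule.sum_mem _ fun i _ => Submodule.smul_mem _ _ (Submodule.subset_span ⟨⟨z, i⟩, rfl⟩)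
  let b₀ := HilbertBasis.mkOfOrthogonalEqBot hv hspan
  have hb₀ : ∀ i, b₀ i = v i := fun i =>
    congrFun (HilbertBasis.coe_mkOfOrthogonalEqBot hv hspan) i
  have hinf : Infinite ι := by
    by_contra hfin
    rw [not_infinite_iff_finite] at hfin
    have := Fintype.ofFinite ι
    exact hdim (b₀.toOrthonormalBasis.toBasis.finiteDimensional_of_finite)
  have hfin : ∀ c : ℝ, 0 < c → {i : ι | c ≤ i.1.re}.Finite := fun c hc =>
    finite_le_of_isCompactOperator hK hv hvK hc
  obtain ⟨e, he⟩ := exists_equiv_nat_antitone (fun i : ι => i.1.re) hf hfin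
  have hve : Orthonormal ℂ (v ∘ e) := hv.comp e e.injective
  have hspane : (Submodule.span ℂ (Set.range (v ∘ e)))ᗮ = ⊥ := by
    rw [e.surjective.range_comp]; exact hspan
  refine ⟨HilbertBasis.mkOfOrthogonalEqBot hve hspane, fun k => (e k).1.re, he, fun k => hf _,
    ?_, fun k => ?_⟩
  · rw [Metric.tendsto_atTop]
    intro c hc
    have h1 : {k : ℕ | c ≤ (e k).1.re}.Finite := 
      Set.Finite.preimage (f := e) e.injective.injOn (hfin c hc)
    obtain ⟨N, hN⟩ := h1.bddAbove
    refine ⟨N + 1, fun k hk => ?_⟩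
    rw [Real.dist_eq, sub_zero, abs_of_pos (hf _)]
    by_contra! h
    have := hN h
    omega
  · rw [HilbertBasis.coe_mkOfOrthogonalEqBot]
    exact hvK _

end Diagonalization

/-! ### Singular systems -/

section SingularSystem

variable {X Y : Type*} [NormedAddCommGroup X] [InnerProductSpace ℂ X] [NormedAddCommGroup Y]
  [InnerProductSpace ℂ Y]

/-- The singular value decomposition `T u = ∑ s_k (x_k, u) b_k` of an operator of infinite rank,
with singular values in decreasing order. -/
structure IsSingularSystem (T : X →L[ℂ] Y) (x : ℕ → X) (b : HilbertBasis ℕ ℂ Y) (s : ℕ → ℝ) :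
    Prop where
  orthonormal : Orthonormal ℂ x
  antitone : Antitone s
  pos : ∀ k, 0 < s k
  tendsto : Filter.Tendsto s Filter.atTop (nhds 0)
  map_eq : ∀ k, T (x k) = (s k : ℂ) • b k
  inner_eq : ∀ k u, inner ℂ (b k) (T u) = (s k : ℂ) * inner ℂ (x k) u

lemma _root_.Orthonormal.norm_sum_smul_sq {ι : Type*} [Fintype ι] {v : ι → X}
    (hv : Orthonormal ℂ v) (c : ι → ℂ) : ‖∑ i, c i • v i‖ ^ 2 = ∑ i, ‖c i‖ ^ 2 := by
  have h := hv.inner_sum c c Finset.univ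
  rw [inner_self_eq_norm_sq_to_K] at h
  have h2 : (((‖∑ i, c i • v i‖ ^ 2 : ℝ)) : ℂ) = ((∑ i, ‖c i‖ ^ 2 : ℝ) : ℂ) := by
    push_cast
    refine Eq.trans h (Finset.sum_congr rfl fun i _ => ?_)
    exact Complex.conj_mul' (c i)
  exact_mod_cast h2

lemma _root_.HilbertBasis.hasSum_norm_inner_sq (b : HilbertBasis ℕ ℂ Y) (y : Y) :
    HasSum (fun k => ‖inner ℂ (b k) y‖ ^ 2) (‖y‖ ^ 2) := by
  rw [← Complex.hasSum_ofReal]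
  have h := b.hasSum_inner_mul_inner y y
  rw [inner_self_eq_norm_sq_to_K] at h
  have h2 : (fun k => ((‖inner ℂ (b k) y‖ ^ 2 : ℝ) : ℂ)) =
      fun k => inner ℂ y (b k) * inner ℂ (b k) y := by
    funext k
    rw [← inner_conj_symm y (b k), Complex.conj_mul']
    norm_cast
  rw [h2]
  exact_mod_cast h

/-- A finite-dimensional space of dimension greater than `N` contains a non-zero vector orthogonal
to `N` given vectors. -/
lemma exists_ne_zero_orthogonal (V : Submodule ℂ X) [FiniteDimensional ℂ V] (x : ℕ → X) {N : ℕ}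
    (hN : N < Module.finrank ℂ V) : ∃ u ∈ V, u ≠ 0 ∧ ∀ k < N, inner ℂ (x k) u = 0 := by
  let f : V →ₗ[ℂ] (Fin N → ℂ) :=
    LinearMap.pi fun k => ((innerSL ℂ (x k) : X →L[ℂ] ℂ) : X →ₗ[ℂ] ℂ) ∘ₗ V.subtype
  have hf : LinearMap.ker f ≠ ⊥ := LinearMap.ker_ne_bot_of_finrank_lt (by simpa using hN)
  obtain ⟨u, hu, hu0⟩ := Submodule.exists_mem_ne_zero_of_ne_bot hf
  refine ⟨u, u.2, by simpa using hu0, fun k hk => ?_⟩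
  exact congrFun (LinearMap.mem_ker.1 hu) ⟨k, hk⟩

/-- Rank-nullity for the restriction of `S` to `V`. It gives the lower bound for approximation
numbers: on the vector found here, `T - S` agrees with `T`. -/
lemma exists_ne_zero_map_eq_zero (V : Submodule ℂ X) [FiniteDimensional ℂ V] (S : X →L[ℂ] Y)
    (hS : LinearMap.rank (S : X →ₗ[ℂ] Y) < (Module.finrank ℂ V : Cardinal)) :
    ∃ u ∈ V, u ≠ 0 ∧ S u = 0 := by
  -- Finiteness comes first, so that `finrank` of the range is the true rank and not the default
  -- value 0.
  have hfin : FiniteDimensional ℂ (LinearMap.range (S : X →ₗ[ℂ] Y)) :=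
    Module.rank_lt_aleph0_iff.1 (hS.trans Cardinal.natCast_lt_aleph0)
  let f : V →ₗ[ℂ] LinearMap.range (S : X →ₗ[ℂ] Y) := (S : X →ₗ[ℂ] Y).rangeRestrict ∘ₗ V.subtype
  have hlt : Module.finrank ℂ (LinearMap.range (S : X →ₗ[ℂ] Y)) < Module.finrank ℂ V := by
    rw [LinearMap.rank, ← Module.finrank_eq_rank] at hS
    exact_mod_cast hS
  obtain ⟨u, hu, hu0⟩ := Submodule.exists_mem_ne_zero_of_ne_bot
    (LinearMap.ker_ne_bot_of_finrank_lt (f := f) hlt)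
  exact ⟨u, u.2, by simpa using hu0, congrArg Subtype.val (LinearMap.mem_ker.1 hu)⟩

/-- The span of the first `N` right singular vectors. -/
def leadingSpan (x : ℕ → X) (N : ℕ) : Submodule ℂ X :=
  Submodule.span ℂ (Set.range fun k : Fin N => x k)

instance (x : ℕ → X) (N : ℕ) : FiniteDimensional ℂ (leadingSpan x N) :=
  FiniteDimensional.span_of_finite ℂ (Set.finite_range _)

lemma finrank_leadingSpan {x : ℕ → X} (hx : Orthonormal ℂ x) (N : ℕ) :
    Module.finrank ℂ (leadingSpan x N) = N := by
  have := finrank_span_eq_card (R := ℂ)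
    (hx.comp (fun k : Fin N => (k : ℕ)) Fin.val_injective).linearIndependent
  rw [Fintype.card_fin] at this
  exact this

/-- Since the quotient is taken in [0, ∞], a non-zero `u` with `T u = 0` contributes ∞. The bound
therefore forces `T` to be injective on `V`, as the inequality on the right does. -/
lemma alphaNumber_le_iff (T : X →L[ℂ] Y)
    (V : Submodule ℂ X) {ε : ℝ} (hε : 0 < ε) :
    alphaNumber T V ≤ ENNReal.ofReal (1 / ε) ↔ ∀ u ∈ V, ε * ‖u‖ ≤ ‖T u‖ := by
  have key : ∀ u : X, ‖u‖ₑ / ‖T u‖ₑ ≤ ENNReal.ofReal (1 / ε) ↔ ε * ‖u‖ ≤ ‖T u‖ := by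
    intro u
    rw [ENNReal.div_le_iff_le_mul (Or.inr ENNReal.ofReal_ne_top) (Or.inl enorm_ne_top),
      ← ofReal_norm, ← ofReal_norm, ← ENNReal.ofReal_mul (by positivity),
      ENNReal.ofReal_le_ofReal_iff (by positivity), one_div, ← div_eq_inv_mul, le_div_iff₀ hε,
      mul_comm]
  constructor
  · intro h u hu
    by_cases hu0 : u = 0
    · simp [hu0]
    · exact (key u).1 ((le_iSup₂ (f := fun (u : X) (_ : u ∈ {u : X | u ∈ V ∧ u ≠ 0}) =>
        ‖u‖ₑ / ‖T u‖ₑ) u ⟨hu, hu0⟩).trans h)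
  · exact fun h => iSup₂_le fun u hu => (key u).2 (h u hu.1)

namespace IsSingularSystem

variable {T : X →L[ℂ] Y} {x : ℕ → X} {b : HilbertBasis ℕ ℂ Y} {s : ℕ → ℝ}

/-- In the orthonormal systems `x` and `b` the restriction of `T` is diagonal with entries at least
`ε`. -/
lemma le_norm_map (h : IsSingularSystem T x b s) {N : ℕ} {ε : ℝ} (hε : 0 ≤ ε)
    (hN : ∀ k < N, ε ≤ s k) {u : X} (hu : u ∈ leadingSpan x N) : ε * ‖u‖ ≤ ‖T u‖ := by
  obtain ⟨c, rfl⟩ := (Submodule.mem_span_range_iff_exists_fun ℂ).1 hu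
  have h1 : ‖∑ i, c i • x i‖ ^ 2 = ∑ i, ‖c i‖ ^ 2 :=
    (h.orthonormal.comp (fun k : Fin N => (k : ℕ)) Fin.val_injective).norm_sum_smul_sq c
  have h2 : ‖T (∑ i, c i • x i)‖ ^ 2 = ∑ i, ‖c i * s i‖ ^ 2 := by
    rw [← (b.orthonormal.comp (fun k : Fin N => (k : ℕ)) Fin.val_injective).norm_sum_smul_sq]
    simp only [map_sum, map_smul, h.map_eq, smul_smul, Function.comp_apply]
  refine le_of_pow_le_pow_left₀ two_ne_zero (norm_nonneg _) ?_
  rw [mul_pow, h1, h2, Finset.mul_sum]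
  refine Finset.sum_le_sum fun i _ => ?_
  rw [norm_mul, mul_pow, mul_comm, Complex.norm_real, Real.norm_of_nonneg (h.pos _).le]
  have := hN i i.2
  gcongr

/-- Parseval for `T u` in the basis `b`, then Bessel for `u`: the first `N` terms vanish and the
others carry a factor at most `s N ^ 2`. Completeness of `x` is not needed. -/
lemma norm_map_le (h : IsSingularSystem T x b s) {N : ℕ} {u : X}
    (hu : ∀ k < N, inner ℂ (x k) u = 0) : ‖T u‖ ≤ s N * ‖u‖ := by
  refine le_of_pow_le_pow_left₀ two_ne_zero (mul_nonneg (h.pos N).le (norm_nonneg _)) ?_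
  have h1 := b.hasSum_norm_inner_sq (T u)
  have h2 := h.orthonormal.inner_products_summable u
  have h3 := hasSum_le (fun k => ?_) h1 (h2.hasSum.mul_left (s N ^ 2))
  · rw [mul_pow]
    exact h3.trans (mul_le_mul_of_nonneg_left (h.orthonormal.tsum_inner_products_le u)
      (sq_nonneg _))
  · rw [h.inner_eq, norm_mul, mul_pow, Complex.norm_real, Real.norm_of_nonneg (h.pos _).le]
    rcases lt_or_ge k N with hk | hk
    · simp [hu k hk]
    · have := h.antitone hk
      have := (h.pos k).le
      gcongr

/-- The approximation numbers are the singular values. -/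
lemma approxNumber_eq (h : IsSingularSystem T x b s) (N : ℕ) : approxNumber T (N + 1) = s N := by
  have hlb : ∀ r ∈ {r : ℝ | ∃ S : X →L[ℂ] Y,
      LinearMap.rank (S : X →ₗ[ℂ] Y) < ((N + 1 : ℕ) : Cardinal) ∧ r = ‖T - S‖}, s N ≤ r := by
    rintro _ ⟨S, hS, rfl⟩
    -- An operator of rank at most `N` annihilates a non-zero vector of the `N + 1`-dimensional
    -- leading span, where `T` expands by at least `s N`.
    rw [← finrank_leadingSpan h.orthonormal (N + 1)] at hS
    obtain ⟨u, hu, hu0, hSu⟩ := exists_ne_zero_map_eq_zero _ S hS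
    have h1 := h.le_norm_map (h.pos N).le (fun k hk => h.antitone (Nat.lt_succ_iff.1 hk)) hu
    have h2 := (T - S).le_opNorm u
    rw [sub_apply, hSu, sub_zero] at h2
    exact le_of_mul_le_mul_right (h1.trans h2) (norm_pos_iff.2 hu0)
  -- The optimal approximation truncates the singular value expansion after `N` terms.
  let P := (leadingSpan x N).starProjection
  have hmem : ‖T - T ∘L P‖ ∈ {r : ℝ | ∃ S : X →L[ℂ] Y,
      LinearMap.rank (S : X →ₗ[ℂ] Y) < ((N + 1 : ℕ) : Cardinal) ∧ r = ‖T - S‖} := by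
    refine ⟨T ∘L P, ?_, rfl⟩
    have h1 : LinearMap.range ((T ∘L P : X →L[ℂ] Y) : X →ₗ[ℂ] Y) ≤
        (leadingSpan x N).map (T : X →ₗ[ℂ] Y) := by
      rintro _ ⟨u, rfl⟩
      exact ⟨P u, Submodule.starProjection_apply_mem _ u, rfl⟩
    refine (Submodule.rank_mono h1).trans_lt ?_
    rw [← Module.finrank_eq_rank]
    have h2 := Submodule.finrank_map_le (T : X →ₗ[ℂ] Y) (leadingSpan x N)
    rw [finrank_leadingSpan h.orthonormal] at h2
    exact_mod_cast Nat.lt_succ_of_le h2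
  refine le_antisymm ((csInf_le ⟨s N, hlb⟩ hmem).trans ?_) (le_csInf ⟨_, hmem⟩ hlb)
  refine ContinuousLinearMap.opNorm_le_bound _ (h.pos N).le fun u => ?_
  have h3 : ‖u - P u‖ ≤ ‖u‖ := by
    rw [← Submodule.starProjection_orthogonal_val]
    exact Submodule.norm_starProjection_apply_le _ u
  have h5 : ∀ k < N, inner ℂ (x k) (u - P u) = 0 := fun k hk =>
    Submodule.sub_starProjection_mem_orthogonal u (x k) (Submodule.subset_span ⟨⟨k, hk⟩, rfl⟩)
  have h6 := h.norm_map_le h5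
  rw [map_sub] at h6
  exact h6.trans (mul_le_mul_of_nonneg_left h3 (h.pos N).le)

/-- Monotonicity makes the indices with `ε ≤ s k` an initial segment, and `s → 0` makes it finite.
Its length is the common value of all the counting numbers. -/
lemma exists_le_iff_lt (h : IsSingularSystem T x b s) {ε : ℝ} (hε : 0 < ε) :
    ∃ N, ∀ k, ε ≤ s k ↔ k < N := by
  have hex : ∃ k, s k < ε := ((tendsto_order.1 h.tendsto).2 ε hε).exists
  classical
  refine ⟨Nat.find hex, fun k => ⟨fun hk => ?_, fun hk => not_lt.1 (Nat.find_min hex hk)⟩⟩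
  by_contra! hle
  exact absurd (Nat.find_spec hex) (not_lt.2 (hk.trans (h.antitone hle)))

/-- Approximation numbers are indexed from 1 and singular values from 0, so the largest admissible
index is the number of admissible singular values. -/
lemma nuZero_eq (h : IsSingularSystem T x b s) {ε : ℝ} {N : ℕ}
    (hN : ∀ k, ε ≤ s k ↔ k < N) : nuZero T ε = N := by
  refine le_antisymm (iSup₂_le fun k hk => ?_) ?_
  · obtain ⟨j, rfl⟩ := Nat.exists_eq_add_of_le' hk.1
    have := hk.2
    rw [h.approxNumber_eq, hN] at this
    exact_mod_cast this
  · rcases N with _ | N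
    · simp
    · refine le_iSup₂_of_le (N + 1) ⟨by omega, ?_⟩ le_rfl
      rw [h.approxNumber_eq, hN]
      omega

/-- The leading span attains dimension `N`. A space of larger dimension contains a non-zero vector
orthogonal to the first `N` of the `x k`; on it `T` contracts by `s N < ε`. -/
lemma muZero_eq (h : IsSingularSystem T x b s) {ε : ℝ} (hε : 0 < ε) {N : ℕ}
    (hN : ∀ k, ε ≤ s k ↔ k < N) : muZero T ε = N := by
  refine le_antisymm (iSup₂_le ?_) ?_
  · rintro V ⟨hfin, hV⟩
    rw [alphaNumber_le_iff T V hε] at hV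
    by_contra! hlt
    obtain ⟨u, hu, hu0, hxu⟩ := exists_ne_zero_orthogonal V x (N := N) (by exact_mod_cast hlt)
    have h1 := (hV u hu).trans (h.norm_map_le hxu)
    have h2 := le_of_mul_le_mul_right h1 (norm_pos_iff.2 hu0)
    rw [hN] at h2
    omega
  · refine le_iSup₂_of_le (leadingSpan x N) ⟨inferInstance, ?_⟩ ?_
    · rw [alphaNumber_le_iff T _ hε]
      exact fun u hu => h.le_norm_map hε.le (fun k hk => (hN k).2 hk) hu
    · rw [finrank_leadingSpan h.orthonormal]

end IsSingularSystem

/-- A compact injective operator between Hilbert spaces with injective adjoint has a singular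
system, which diagonalizes `T T†`. -/
theorem exists_isSingularSystem [CompleteSpace X] [CompleteSpace Y]
    (hdim : ¬ FiniteDimensional ℂ Y) {T : X →L[ℂ] Y} (hT : IsCompactOperator T)
    (hinj : Function.Injective (ContinuousLinearMap.adjoint T)) :
    ∃ x b s, IsSingularSystem T x b s ∧
      ∀ k, (T ∘L ContinuousLinearMap.adjoint T) (b k) = ((s k ^ 2 : ℝ) : ℂ) • b k := by
  set T' := ContinuousLinearMap.adjoint T with hT'
  have hK : IsCompactOperator (T ∘L T') := hT.comp_clm T'
  have hin : ∀ y z, inner ℂ y ((T ∘L T') z) = inner ℂ (T' y) (T' z) := fun y z =>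
    (ContinuousLinearMap.adjoint_inner_left T (T' z) y).symm
  have hsymm : (T ∘L T').IsSymmetric := by
    intro y z
    refine Eq.trans ?_ (hin y z).symm
    rw [← inner_conj_symm]
    exact (congrArg _ (hin z y)).trans (inner_conj_symm _ _)
  have hpos : ∀ y ≠ 0, 0 < (inner ℂ y ((T ∘L T') y)).re := by
    intro y hy
    rw [hin]
    have : 0 < ‖T' y‖ ^ 2 := by
      have : T' y ≠ 0 := (map_ne_zero_iff T' hinj).2 hy
      positivity
    exact this.trans_eq (inner_self_eq_norm_sq (𝕜 := ℂ) (T' y)).symm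
  obtain ⟨b, ev, hanti, hev, hlim, hb⟩ := exists_hilbertBasis_eigenvectors hdim hK hsymm hpos
  have hs : ∀ k, 0 < Real.sqrt (ev k) := fun k => Real.sqrt_pos.2 (hev k)
  have hsc : ∀ k, (Real.sqrt (ev k) : ℂ) ≠ 0 := fun k => by exact_mod_cast (hs k).ne'
  have hsq : ∀ k, (Real.sqrt (ev k) : ℂ) * Real.sqrt (ev k) = ev k := fun k => by
    exact_mod_cast Real.mul_self_sqrt (hev k).le
  -- The vectors `T' (b k)` are orthogonal with squared norm `ev k`, because their inner products
  -- are those of `b i` and `T T' (b j)`; dividing by the square root normalizes them.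
  refine ⟨fun k => (Real.sqrt (ev k) : ℂ)⁻¹ • T' (b k), b, fun k => Real.sqrt (ev k),
    ⟨?_, fun i j hij => Real.sqrt_le_sqrt (hanti hij), hs, ?_, fun k => ?_, fun k u => ?_⟩,
    fun k => ?_⟩
  · classical
    rw [orthonormal_iff_ite]
    intro i j
    rw [inner_smul_left, inner_smul_right, ← hin, hb, inner_smul_right,
      orthonormal_iff_ite.1 b.orthonormal i j]
    split_ifs with hij
    · subst hij
      rw [← hsq]
      have := hsc i
      simp only [map_inv₀, Complex.conj_ofReal]
      field_simp
    · simp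
  · have := (Real.continuous_sqrt.tendsto 0).comp hlim
    rw [Real.sqrt_zero] at this
    exact this
  · have h1 : T (T' (b k)) = (ev k : ℂ) • b k := hb k
    rw [map_smul, h1, smul_smul, ← hsq, inv_mul_cancel_left₀ (hsc k)]
  · rw [inner_smul_left, ContinuousLinearMap.adjoint_inner_left]
    simp only [map_inv₀, Complex.conj_ofReal]
    rw [mul_inv_cancel_left₀ (hsc k)]
  · rw [Real.sq_sqrt (hev k).le]
    exact hb k

end SingularSystem

/-! ### Inverses of compact operators -/

section InverseOperator

variable {H : Type*} [NormedAddCommGroup H] [InnerProductSpace ℂ H] {A : H →ₗ.[ℂ] H}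
  {K : H →L[ℂ] H}

/-- In this section `hA` expresses `A = K⁻¹` as an identity of graphs, so facts about the unbounded
`A` reduce to facts about the bounded `K`. -/
lemma range_eq_domain (hA : ∀ f h, (f, h) ∈ A.graph ↔ f = K h) :
    LinearMap.range (K : H →ₗ[ℂ] H) = A.domain := by
  ext f
  constructor
  · rintro ⟨h, rfl⟩
    exact LinearPMap.mem_domain_of_mem_graph ((hA _ h).2 rfl)
  · exact fun hf => ⟨A ⟨f, hf⟩, ((hA _ _).1 (A.mem_graph ⟨f, hf⟩)).symm⟩

lemma apply_apply_eq (hA : ∀ f h, (f, h) ∈ A.graph ↔ f = K h) (f : A.domain) : K (A f) = f :=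
  ((hA _ _).1 (A.mem_graph f)).symm

lemma exists_apply_eq (hA : ∀ f h, (f, h) ∈ A.graph ↔ f = K h) {f h : H}
    (hf : f = K h) : ∃ hd : f ∈ A.domain, A ⟨f, hd⟩ = h :=
  ⟨LinearPMap.mem_domain_of_mem_graph ((hA f h).2 hf),
    ((LinearPMap.image_iff _).2 ((hA f h).2 hf)).symm⟩

/-- The inverse of a bounded injective symmetric operator is self-adjoint. -/
theorem isSelfAdjoint_of_graph [CompleteSpace H] (hA : ∀ f h, (f, h) ∈ A.graph ↔ f = K h)
    (hsymm : K.IsSymmetric) (hinj : Function.Injective K) : IsSelfAdjoint A := by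
  have hdense : Dense (A.domain : Set H) := by
    rw [← range_eq_domain hA, Submodule.dense_iff_topologicalClosure_eq_top,
      Submodule.topologicalClosure_eq_top_iff, Submodule.eq_bot_iff]
    intro y hy
    -- A vector orthogonal to the range of a symmetric operator lies in its kernel; it suffices to
    -- test against `K (K y)`.
    have h1 : inner ℂ (K y) (K y) = 0 := (hsymm (K y) y).symm.trans (hy _ ⟨K y, rfl⟩)
    exact (map_eq_zero_iff K hinj).1 (inner_self_eq_zero.1 h1)
  rw [LinearPMap.isSelfAdjoint_def]
  refine LinearPMap.eq_of_eq_graph ?_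
  rw [LinearPMap.adjoint_graph_eq_graph_adjoint hdense]
  ext ⟨f, h⟩
  rw [Submodule.mem_adjoint_iff, hA]
  constructor
  · intro hfh
    refine ext_inner_left ℂ fun b => ?_
    have h1 := hfh (K b) b ((hA _ _).2 rfl)
    rw [sub_eq_zero] at h1
    exact h1.trans (hsymm b h)
  · rintro rfl a b hab
    rw [(hA _ _).1 hab, sub_eq_zero]
    exact (hsymm b h).symm

/-- Applying `K` to `A f = z f` loses nothing. Keeping `z` on the right, rather than dividing by it,
covers `z = 0` as well. -/
lemma mem_eigenspace_iff_of_graph (hA : ∀ f h, (f, h) ∈ A.graph ↔ f = K h) (z : ℂ) (f : H) :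
    f ∈ eigenspace A z ↔ f = z • K f := by
  rw [← map_smul]
  constructor
  · rintro ⟨g, hg, rfl⟩
    have h1 : A g = z • (g : H) := sub_eq_zero.1 hg
    have h2 := (apply_apply_eq hA g).symm
    rwa [h1] at h2
  · intro hf
    have h1 := (hA f (z • f)).2 hf
    have hd : f ∈ A.domain := LinearPMap.mem_domain_of_mem_graph h1
    refine ⟨⟨f, hd⟩, ?_, rfl⟩
    exact sub_eq_zero.2 ((LinearPMap.image_iff hd).2 h1).symm

/-- The resolvent set of the inverse of a compact operator contains all complex numbers which are
not eigenvalues. -/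
lemma mem_resolventSet_of_graph [CompleteSpace H] (hA : ∀ f h, (f, h) ∈ A.graph ↔ f = K h)
    (hK : IsCompactOperator K) {z : ℂ} (hz : eigenspace A z = ⊥) :
    z ∈ DegSobolev.resolventSet A := by
  rcases eq_or_ne z 0 with rfl | hz0
  · refine ⟨K, fun h => ?_, fun f => ?_⟩
    · obtain ⟨hd, h1⟩ := exists_apply_eq hA (rfl : K h = K h)
      exact ⟨hd, by rw [h1, zero_smul, sub_zero]⟩
    · rw [zero_smul, sub_zero, apply_apply_eq hA]
  · have hne : ¬ Module.End.HasEigenvalue (K : Module.End ℂ H) z⁻¹ := by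
      intro hev
      obtain ⟨v, hv, hv0⟩ := hev.exists_hasEigenvector
      have h1 : K v = z⁻¹ • v := Module.End.mem_eigenspace_iff.1 hv
      have h2 : v ∈ eigenspace A z := by
        rw [mem_eigenspace_iff_of_graph hA, h1, smul_inv_smul₀ hz0]
      rw [hz] at h2
      exact hv0 h2
    obtain ⟨V, hV⟩ := spectrum.mem_resolventSet_iff.1
      ((hK.hasEigenvalue_or_mem_resolventSet (inv_ne_zero hz0)).resolve_left hne)
    have hVapp : ∀ w, (V : H →L[ℂ] H) w = z⁻¹ • w - K w := fun w => by
      rw [hV, Algebra.algebraMap_eq_smul_one]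
      rfl
    let W : H →L[ℂ] H := ↑(V⁻¹)
    have hVW : ∀ w, z⁻¹ • W w - K (W w) = w := fun w => by
      rw [← hVapp]
      exact DFunLike.congr_fun V.mul_inv w
    have hWV : ∀ w, W (z⁻¹ • w - K w) = w := fun w => by
      rw [← hVapp]
      exact DFunLike.congr_fun V.inv_mul w
    -- From `A - z = z (z⁻¹ - K) K⁻¹` the resolvent must be `z⁻¹ K (z⁻¹ - K)⁻¹`, where `W = (z⁻¹ -
    -- K)⁻¹` exists by the Fredholm alternative.
    refine ⟨z⁻¹ • (K ∘L W), fun h => ?_, fun f => ?_⟩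
    · have h2 : (z⁻¹ • (K ∘L W)) h = K (z⁻¹ • W h) := by rw [map_smul]; rfl
      obtain ⟨hd, h1⟩ := exists_apply_eq hA h2
      exact ⟨hd, by rw [h1, h2, map_smul, smul_inv_smul₀ hz0, hVW]⟩
    · have h1 := apply_apply_eq hA f
      have h2 : A f - z • (f : H) = z • (z⁻¹ • A f - K (A f)) := by
        rw [smul_sub, smul_inv_smul₀ hz0, h1]
      rw [h2, smul_apply, ContinuousLinearMap.comp_apply, map_smul, hWV, map_smul,
        inv_smul_smul₀ hz0, h1]

variable {b : HilbertBasis ℕ ℂ H} {ev : ℕ → ℝ}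

lemma inner_apply_eq (hsymm : K.IsSymmetric) (hb : ∀ k, K (b k) = (ev k : ℂ) • b k) (k : ℕ)
    (f : H) : inner ℂ (b k) (K f) = ev k * inner ℂ (b k) f := by
  refine (hsymm (b k) f).symm.trans ?_
  have h1 : ((K : H →ₗ[ℂ] H) (b k)) = (ev k : ℂ) • b k := hb k
  rw [h1, inner_smul_left, Complex.conj_ofReal]

/-- The eigenspaces of the inverse of a diagonal operator. -/
lemma eigenspace_eq_span (hA : ∀ f h, (f, h) ∈ A.graph ↔ f = K h) (hsymm : K.IsSymmetric)
    (hev : ∀ k, 0 < ev k) (hb : ∀ k, K (b k) = (ev k : ℂ) • b k) (z : ℂ) {J : Finset ℕ}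
    (hJ : ∀ k, k ∈ J ↔ ((ev k)⁻¹ : ℝ) = z) :
    eigenspace A z = Submodule.span ℂ (Set.range fun k : J => b k) := by
  have hc : ∀ k, (ev k : ℂ) ≠ 0 := fun k => by exact_mod_cast (hev k).ne'
  refine le_antisymm (fun f hf => ?_) ?_
  · rw [mem_eigenspace_iff_of_graph hA] at hf
    have h0 : ∀ k ∉ J, b.repr f k • b k = 0 := by
      intro k hk
      have h1 := congrArg (inner ℂ (b k)) hf
      rw [inner_smul_right, inner_apply_eq hsymm hb] at h1
      rw [b.repr_apply_apply]
      by_contra hne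
      have h2 : inner ℂ (b k) f ≠ 0 := fun h => hne (by rw [h, zero_smul])
      refine hk ((hJ k).2 ?_)
      have h3 : z * ev k = 1 := by
        refine mul_right_cancel₀ h2 ?_
        rw [one_mul, mul_assoc]
        exact h1.symm
      rw [Complex.ofReal_inv]
      exact (eq_inv_of_mul_eq_one_left h3).symm
    have h4 := (b.hasSum_repr f).unique (hasSum_sum_of_ne_finset_zero h0)
    rw [h4]
    exact Submodule.sum_mem _ fun k hk =>
      Submodule.smul_mem _ _ (Submodule.subset_span ⟨⟨k, hk⟩, rfl⟩)
  · rw [Submodule.span_le]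
    rintro _ ⟨⟨k, hk⟩, rfl⟩
    refine (mem_eigenspace_iff_of_graph hA z (b k)).2 ?_
    rw [hb, ← (hJ k).1 hk, smul_smul, Complex.ofReal_inv, inv_mul_cancel₀ (hc k), one_smul]

/-- The inverse of a compact positive diagonal operator has pure point spectrum, and the inverses
of the diagonal entries form its eigenvalue sequence. -/
theorem hasPurePointSpectrum_of_graph [CompleteSpace H]
    (hA : ∀ f h, (f, h) ∈ A.graph ↔ f = K h) (hK : IsCompactOperator K) (hsymm : K.IsSymmetric)
    (hev : ∀ k, 0 < ev k) (hanti : Antitone ev) (hlim : Filter.Tendsto ev Filter.atTop (nhds 0))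
    (hb : ∀ k, K (b k) = (ev k : ℂ) • b k) :
    HasPurePointSpectrum A ∧ IsEigenvalueSequence A (fun k => (ev k)⁻¹) ∧
      Filter.Tendsto (fun k => (ev k)⁻¹) Filter.atTop Filter.atTop := by
  have htop : Filter.Tendsto (fun k => (ev k)⁻¹) Filter.atTop Filter.atTop :=
    Filter.Tendsto.inv_tendsto_nhdsGT_zero (tendsto_nhdsWithin_iff.2
      ⟨hlim, Filter.Eventually.of_forall hev⟩)
  have hbdd : ∀ r : ℝ, {k | (ev k)⁻¹ ≤ r}.Finite := by
    intro r
    obtain ⟨N, hN⟩ := Filter.eventually_atTop.1 (htop.eventually_gt_atTop r)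
    refine (Set.finite_Iio N).subset fun k hk => ?_
    by_contra! h
    exact absurd hk (not_le.2 (hN k (by simpa using h)))
  have hball : ∀ z : ℂ, {k | dist (((ev k)⁻¹ : ℝ) : ℂ) z < 1}.Finite := by
    intro z
    refine (hbdd (‖z‖ + 1)).subset fun k hk => ?_
    have h1 : ‖(((ev k)⁻¹ : ℝ) : ℂ)‖ ≤ dist (((ev k)⁻¹ : ℝ) : ℂ) z + ‖z‖ := by
      rw [dist_eq_norm]
      exact norm_le_norm_sub_add _ _
    rw [Complex.norm_real, Real.norm_of_nonneg (inv_pos.2 (hev k)).le] at h1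
    have h2 : dist (((ev k)⁻¹ : ℝ) : ℂ) z < 1 := hk
    change (ev k)⁻¹ ≤ ‖z‖ + 1
    linarith
  have hJfin : ∀ z : ℂ, {k | (((ev k)⁻¹ : ℝ) : ℂ) = z}.Finite := fun z =>
    (hball z).subset fun k hk => by
      change dist _ _ < 1
      rw [show (((ev k)⁻¹ : ℝ) : ℂ) = z from hk, dist_self]
      exact one_pos
  have hspan : ∀ z, eigenspace A z =
      Submodule.span ℂ (Set.range fun k : (hJfin z).toFinset => b k) := fun z =>
    eigenspace_eq_span hA hsymm hev hb z fun k => by simp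
  have hfd : ∀ z, FiniteDimensional ℂ (eigenspace A z) := fun z => by
    rw [hspan]
    exact FiniteDimensional.span_of_finite ℂ (Set.finite_range _)
  have hmem : ∀ z, (∃ k, (((ev k)⁻¹ : ℝ) : ℂ) = z) → eigenspace A z ≠ ⊥ := by
    rintro z ⟨k, hk⟩ h0
    have h1 : b k ∈ eigenspace A z := by
      rw [hspan]
      exact Submodule.subset_span ⟨⟨k, by simpa using hk⟩, rfl⟩
    rw [h0] at h1
    exact b.orthonormal.ne_zero k h1
  have hspec : ∀ z ∈ spectrumSet A, ∃ k, (((ev k)⁻¹ : ℝ) : ℂ) = z := by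
    intro z hz
    by_contra! h
    refine hz (mem_resolventSet_of_graph hA hK ?_)
    have : (hJfin z).toFinset = ∅ := by
      ext k
      simpa using h k
    rw [hspan, Submodule.span_eq_bot]
    rintro _ ⟨⟨k, hk⟩, rfl⟩
    exact absurd hk (this ▸ Finset.notMem_empty k)
  refine ⟨⟨fun z hz => hmem z (hspec z hz), fun z _ => hfd z, fun z _ => ?_, ?_⟩, ⟨?_, ?_⟩, htop⟩
  -- Only finitely many eigenvalues lie in the unit disc about `z`. Without `z` itself they form a
  -- closed set, whose complement contains a disc about `z`.
  · have h1 : ((fun k => (((ev k)⁻¹ : ℝ) : ℂ)) ''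
        {k | dist (((ev k)⁻¹ : ℝ) : ℂ) z < 1} \ {z}).Finite := ((hball z).image _).sdiff
    obtain ⟨r, hr, hr'⟩ := Metric.isOpen_iff.1 h1.isClosed.isOpen_compl z (by simp)
    refine ⟨min r 1, lt_min hr one_pos, fun w hw hwz => ?_⟩
    obtain ⟨k, rfl⟩ := hspec w hw
    by_contra hne
    exact hr' (Metric.mem_ball.2 (hwz.trans_le (min_le_left _ _)))
      ⟨⟨k, hwz.trans_le (min_le_right _ _), rfl⟩, hne⟩
  · rw [eq_top_iff, ← b.dense_span]
    refine Submodule.topologicalClosure_mono (Submodule.span_le.2 ?_)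
    rintro _ ⟨k, rfl⟩
    refine (le_iSup (eigenspace A) (((ev k)⁻¹ : ℝ) : ℂ)) ?_
    rw [hspan]
    exact Submodule.subset_span ⟨⟨k, by simp⟩, rfl⟩
  · exact fun i j hij => inv_anti₀ (hev j) (hanti hij)
  · intro z
    have := hfd z
    have hcard : Module.finrank ℂ (eigenspace A z) = (hJfin z).toFinset.card := by
      rw [hspan, ← Fintype.card_coe]
      exact finrank_span_eq_card (b.orthonormal.comp (fun k : (hJfin z).toFinset => (k : ℕ))
        Subtype.val_injective).linearIndependent
    rw [← Module.finrank_eq_rank, hcard, (hJfin z).encard_eq_coe_toFinset_card]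
    simp

end InverseOperator

variable {n : ℕ}

/-! ### Hardy's inequality with an additional slowly varying weight -/

lemma norm_fderiv_self_sq_le (v : Rn n → ℂ) (x y : Rn n) :
    ‖fderiv ℝ v x y‖ ^ 2 ≤ ‖y‖ ^ 2 * ∑ i, ‖partialDeriv i v x‖ ^ 2 := by
  have h1 : ‖fderiv ℝ v x y‖ ≤ ∑ i, |y i| * ‖partialDeriv i v x‖ := by
    rw [fderiv_apply_eq_sum (fderiv ℝ v x) y]
    refine (norm_sum_le _ _).trans (le_of_eq ?_)
    simp [partialDeriv]
  have h2 := Finset.sum_mul_sq_le_sq_mul_sq Finset.univ (fun i => |y i|)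
    (fun i => ‖partialDeriv i v x‖)
  have h3 : ‖y‖ ^ 2 = ∑ i, |y i| ^ 2 := by
    rw [EuclideanSpace.norm_sq_eq]; simp
  rw [h3]
  exact (pow_le_pow_left₀ (norm_nonneg _) h1 2).trans h2

/-- Integrate the radial derivative of F = |x|^{2j} g |v|² by parts, which gives -n ∫ F. In the
pointwise bound the decay of `g` costs F/4, and 2ab ≤ a²/2 + 2b² costs F/2 plus twice the gradient
term; differentiating |x|^{2j} only helps. -/
lemma weighted_hardy_step [NeZero n] (j : ℕ) {g : Rn n → ℝ} (hg : ContDiff ℝ 1 g)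
    (hg0 : ∀ x, 0 ≤ g x) (hgd : ∀ x, -fderiv ℝ g x x ≤ 1 / 4 * g x) {v : Rn n → ℂ}
    (hv : ContDiff ℝ 1 v) (hc : HasCompactSupport v) :
    ∫ x : Rn n, ‖x‖ ^ (2 * j) * g x * ‖v x‖ ^ 2 ≤
      8 * ∑ i, ∫ x : Rn n, ‖x‖ ^ (2 * (j + 1)) * g x * ‖partialDeriv i v x‖ ^ 2 := by
  have hcv := hv.continuous
  have hcg := hg.continuous
  set F : Rn n → ℝ := fun x => (‖x‖ ^ 2) ^ j * g x * ‖v x‖ ^ 2 with hF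
  have hF1 : ContDiff ℝ 1 F := (((contDiff_norm_sq ℝ).pow j).mul hg).mul (hv.norm_sq ℝ)
  have hFc : HasCompactSupport F :=
    (hc.comp_left (g := fun z : ℂ => ‖z‖ ^ 2) (by simp)).mul_left
  have hder : ∀ x : Rn n, fderiv ℝ F x x =
      2 * j * F x + (‖x‖ ^ 2) ^ j * fderiv ℝ g x x * ‖v x‖ ^ 2 +
        (‖x‖ ^ 2) ^ j * g x * (2 * inner ℝ (v x) (fderiv ℝ v x x)) := by
    intro x
    have h1 : HasFDerivAt (fun y : Rn n => ‖y‖ ^ 2) (2 • (innerSL ℝ x)) x := by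
      simpa using (hasStrictFDerivAt_norm_sq x).hasFDerivAt
    have h2 : HasFDerivAt v (fderiv ℝ v x) x := (hv.differentiable (by simp) x).hasFDerivAt
    have h2' : HasFDerivAt g (fderiv ℝ g x) x := (hg.differentiable (by simp) x).hasFDerivAt
    have h3 := ((h1.pow j).mul h2').mul h2.norm_sq
    have h4 : fderiv ℝ F x = _ := h3.fderiv
    rw [h4]
    simp only [hF, smul_eq_mul, nsmul_eq_mul, add_apply, Pi.mul_apply,
      smul_apply, innerSL_apply_apply, real_inner_self_eq_norm_sq,
      ContinuousLinearMap.comp_apply]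
    rcases j with _ | j
    · simp
      ring
    · simp
      ring
  have hFint : Integrable F := hF1.continuous.integrable_of_hasCompactSupport hFc
  have hdc : ∀ i, Integrable fun x : Rn n =>
      ‖x‖ ^ (2 * (j + 1)) * g x * ‖partialDeriv i v x‖ ^ 2 := by
    intro i
    have hp : HasCompactSupport (partialDeriv i v) :=
      hc.of_isClosed_subset isClosed_closure (tsupport_partialDeriv i v)
    have hpc : Continuous (partialDeriv i v) := (contDiff_partialDeriv (k := 0) i hv).continuous
    exact Continuous.integrable_of_hasCompactSupport (by fun_prop)
      ((hp.comp_left (g := fun z : ℂ => ‖z‖ ^ 2) (by simp)).mul_left)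
  have hpt : ∀ x : Rn n, -fderiv ℝ F x x ≤ (3 / 4 : ℝ) * F x +
      2 * ∑ i, ‖x‖ ^ (2 * (j + 1)) * g x * ‖partialDeriv i v x‖ ^ 2 := by
    intro x
    rw [hder x, ← Finset.mul_sum]
    have hi : -inner ℝ (v x) (fderiv ℝ v x x) ≤ ‖v x‖ * ‖fderiv ℝ v x x‖ :=
      (neg_le_abs _).trans (abs_real_inner_le_norm _ _)
    have h5 : -(2 * inner ℝ (v x) (fderiv ℝ v x x)) ≤
        1 / 2 * ‖v x‖ ^ 2 + 2 * (‖x‖ ^ 2 * ∑ i, ‖partialDeriv i v x‖ ^ 2) := by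
      nlinarith [norm_fderiv_self_sq_le v x x, sq_nonneg (‖v x‖ - 2 * ‖fderiv ℝ v x x‖)]
    have h6 : 0 ≤ (‖x‖ ^ 2) ^ j := by positivity
    have h7 := mul_le_mul_of_nonneg_left h5 (mul_nonneg h6 (hg0 x))
    have h8 : 0 ≤ 2 * (j : ℝ) * F x := by
      have := hg0 x
      simp only [hF]; positivity
    have h9 : ‖x‖ ^ (2 * (j + 1)) = (‖x‖ ^ 2) ^ j * ‖x‖ ^ 2 := by
      rw [pow_mul, pow_succ]
    have h10 := mul_le_mul_of_nonneg_left (hgd x) (mul_nonneg h6 (sq_nonneg ‖v x‖))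
    rw [h9]
    simp only [hF] at h8 ⊢
    linarith
  have hInt : Integrable fun x => fderiv ℝ F x x := by
    have hcF : Continuous (fderiv ℝ F) := hF1.continuous_fderiv (by simp)
    refine Continuous.integrable_of_hasCompactSupport (by fun_prop) ?_
    refine (hFc.fderiv (𝕜 := ℝ)).of_isClosed_subset isClosed_closure (closure_mono ?_)
    intro x hx h
    apply hx
    simp [h]
  have hsum := (integrable_finsetSum Finset.univ fun i _ => hdc i).const_mul 2
  have hmono := integral_mono hInt.neg ((hFint.const_mul (3 / 4)).add hsum) (fun x => hpt x)
  simp only [Pi.neg_apply, Pi.add_apply] at hmono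
  rw [integral_neg, integral_fderiv_radial hF1 hFc, integral_add (hFint.const_mul _) hsum,
    integral_const_mul, integral_const_mul, integral_finsetSum _ fun i _ => hdc i] at hmono
  have hn : (1 : ℝ) ≤ n := by exact_mod_cast NeZero.one_le
  have hF0 : 0 ≤ ∫ x, F x := integral_nonneg fun x => by
    have := hg0 x
    simp only [hF]; positivity
  have : ∫ x : Rn n, ‖x‖ ^ (2 * j) * g x * ‖v x‖ ^ 2 = ∫ x, F x := by
    simp only [hF, pow_mul]
  rw [this]
  -- Since `n ≥ 1`, the term 3/4 ∫ F is absorbed on the left and leaves at least 1/4 ∫ F, whence the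
  -- constant 8.
  nlinarith

/-- Each step trades one derivative for two powers of |x|, and the sum over `n` directions turns the
factor 8 into `8 * n`. The index `k` counts the derivatives still missing from order `m`. -/
lemma weighted_hardy_iterate [NeZero n] {m : ℕ} {g : Rn n → ℝ} (hg : ContDiff ℝ 1 g)
    (hg0 : ∀ x, 0 ≤ g x) (hgd : ∀ x, -fderiv ℝ g x x ≤ 1 / 4 * g x) {u : Rn n → ℂ}
    (hu : ContDiff ℝ m u) (hc : HasCompactSupport u) {M : ℝ}
    (hM : ∀ l : List (Fin n), l.length = m →
      ∫ x : Rn n, ‖x‖ ^ (2 * m) * g x * ‖listDeriv l u x‖ ^ 2 ≤ M) (k : ℕ) :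
    ∀ l : List (Fin n), l.length + k = m →
      ∫ x : Rn n, ‖x‖ ^ (2 * l.length) * g x * ‖listDeriv l u x‖ ^ 2 ≤ (8 * n) ^ k * M := by
  induction k with
  | zero =>
    intro l hl
    have hl' : l.length = m := by omega
    rw [hl']; simpa using hM l hl'
  | succ k ih =>
    intro l hl
    have hd : ContDiff ℝ 1 (listDeriv l u) :=
      contDiff_listDeriv (k := 1) l (hu.of_le (by norm_cast; omega))
    refine (weighted_hardy_step l.length hg hg0 hgd hd (hasCompactSupport_listDeriv l hc)).trans ?_
    have h1 : ∀ i ∈ (Finset.univ : Finset (Fin n)),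
        ∫ x : Rn n, ‖x‖ ^ (2 * (l.length + 1)) * g x * ‖partialDeriv i (listDeriv l u) x‖ ^ 2
          ≤ (8 * n) ^ k * M := fun i _ => by
      have := ih (i :: l) (by simp; omega)
      simpa [listDeriv_cons] using this
    have h2 := Finset.sum_le_sum h1
    simp only [Finset.sum_const, Finset.card_univ, Fintype.card_fin, nsmul_eq_mul] at h2
    calc _ ≤ 8 * ((n : ℝ) * ((8 * n) ^ k * M)) := by gcongr
      _ = _ := by ring

/-- Hardy's inequality for weights dominated by the logarithmic factor of `b_{m,σ}`. -/
lemma integral_listDeriv_le [NeZero n] {m : ℕ} [NeZero m] {σ D : ℝ} (hD : 0 ≤ D) {g : Rn n → ℝ}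
    (hg : ContDiff ℝ 1 g) (hg0 : ∀ x, 0 ≤ g x) (hgd : ∀ x, -fderiv ℝ g x x ≤ 1 / 4 * g x)
    (hgw : ∀ x ∈ Metric.ball (0 : Rn n) 1, x ≠ 0 → g x ≤ D * (1 + |Real.log ‖x‖|) ^ (2 * σ))
    (u : testSpace n m) (k : ℕ) (l : List (Fin n)) (hlk : l.length + k = m) :
    ∫ x : Rn n, ‖x‖ ^ (2 * l.length) * g x * ‖listDeriv l u.1 x‖ ^ 2 ≤
      (8 * n) ^ k * (D * ‖testToE n m σ u‖ ^ 2) := by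
  obtain ⟨hu, hc, hs⟩ := u.2
  have hcg := hg.continuous
  refine weighted_hardy_iterate hg hg0 hgd hu hc (fun l hl => ?_) k l hlk
  obtain ⟨α, hα⟩ := exists_multiDeriv_eq l hl
  rw [hα u.1 hu, norm_testToE_sq]
  have h0 : ∀ β : MultiIndex n m, 0 ≤
      ∫ x in Metric.ball (0 : Rn n) 1, weight m σ x * ‖multiDeriv β.1 u.1 x‖ ^ 2 :=
    fun β => integral_nonneg fun x => mul_nonneg (weight_nonneg m σ x) (by positivity)
  refine le_trans ?_ (mul_le_mul_of_nonneg_left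
    (Finset.single_le_sum (fun β _ => h0 β) (Finset.mem_univ α)) hD)
  have hz : ∀ x ∉ Metric.ball (0 : Rn n) 1, multiDeriv α.1 u.1 x = 0 := fun x hx =>
    image_eq_zero_of_notMem_tsupport fun h => hx (hs (tsupport_listDeriv _ _ h))
  have hcont := contDiff_multiDeriv α hu
  have hcs : HasCompactSupport (multiDeriv α.1 u.1) := hasCompactSupport_listDeriv _ hc
  rw [← setIntegral_eq (fun x hx => by simp [hz x hx]), ← integral_const_mul]
  refine setIntegral_mono_on ?_ ?_ Metric.isOpen_ball.measurableSet fun x hx => ?_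
  · refine (Continuous.integrable_of_hasCompactSupport (by fun_prop) ?_).restrict
    exact (hcs.comp_left (g := fun z : ℂ => ‖z‖ ^ 2) (by simp)).mul_left
  · have h := ((memLp_weightedDeriv σ α u).integrable_norm_pow (by simp)).const_mul D
    refine h.congr (Filter.Eventually.of_forall fun x => ?_)
    simp [weightedDeriv, mul_pow, Real.sq_sqrt (weight_nonneg m σ x)]
  · rw [← mul_assoc]
    refine mul_le_mul_of_nonneg_right ?_ (sq_nonneg _)
    -- The domination `hgw` excludes the origin, where both sides vanish because `m ≥ 1`.
    by_cases hx0 : x = 0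
    · simp [hx0, weight, NeZero.ne m]
    · calc ‖x‖ ^ (2 * m) * g x ≤ ‖x‖ ^ (2 * m) * (D * (1 + |Real.log ‖x‖|) ^ (2 * σ)) := by
            have := hgw x hx hx0
            gcongr
        _ = D * weight m σ x := by unfold weight; ring

/-! ### Regularized logarithmic weights and non-concentration at the origin -/

/-- A smooth regularization of the logarithmic factor of `b_{m,σ}`. -/
def logWeight (σ s : ℝ) (x : Rn n) : ℝ :=
  (1 + 8 * σ + 1 / 2 * Real.log (1 + (‖x‖ ^ 2 + s)⁻¹)) ^ (2 * σ)

section LogWeight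

variable {σ s : ℝ}

lemma le_logWeight_base (hs : 0 < s) (x : Rn n) :
    1 + 8 * σ ≤ 1 + 8 * σ + 1 / 2 * Real.log (1 + (‖x‖ ^ 2 + s)⁻¹) := by
  have : 0 ≤ Real.log (1 + (‖x‖ ^ 2 + s)⁻¹) := Real.log_nonneg (by
    have : 0 ≤ (‖x‖ ^ 2 + s)⁻¹ := by positivity
    linarith)
  linarith

lemma contDiff_logWeight (hσ : 0 < σ) (hs : 0 < s) :
    ContDiff ℝ 1 (logWeight σ s : Rn n → ℝ) := by
  unfold logWeight
  refine ContDiff.rpow_const_of_ne (contDiff_const.add (contDiff_const.mul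
    (ContDiff.log (contDiff_const.add (ContDiff.inv ((contDiff_norm_sq ℝ).add contDiff_const)
      fun x => ?_)) fun x => ?_))) fun x => ?_
  · positivity
  · positivity
  · have := le_logWeight_base (σ := σ) hs x
    linarith

lemma logWeight_nonneg (hσ : 0 < σ) (hs : 0 < s) (x : Rn n) : 0 ≤ logWeight σ s x := by
  have := le_logWeight_base (σ := σ) hs x
  exact Real.rpow_nonneg (by linarith) _

/-- With base `B`, the left side is 2σ B^{2σ-1} times a factor at most 1. The summand `8 * σ` in the
base gives 2σ ≤ B/4, which is exactly the slow decay that the weighted Hardy step requires,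
uniformly in `s`. -/
lemma neg_fderiv_logWeight_le (hσ : 0 < σ) (hs : 0 < s) (x : Rn n) :
    -fderiv ℝ (logWeight σ s) x x ≤ 1 / 4 * logWeight σ s x := by
  set q := ‖x‖ ^ 2 with hq
  have hq0 : 0 ≤ q := sq_nonneg _
  have hqs : 0 < q + s := by positivity
  set B := 1 + 8 * σ + 1 / 2 * Real.log (1 + (q + s)⁻¹) with hB
  have hBge : 1 + 8 * σ ≤ B := le_logWeight_base hs x
  have hB0 : 0 < B := by linarith
  have h1 : HasFDerivAt (fun y : Rn n => ‖y‖ ^ 2) (2 • (innerSL ℝ x)) x := by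
    simpa using (hasStrictFDerivAt_norm_sq x).hasFDerivAt
  have h2 : HasDerivAt (fun t : ℝ => (1 + 8 * σ + 1 / 2 * Real.log (1 + (t + s)⁻¹)) ^ (2 * σ))
      ((1 / 2 * (-1 / (q + s) ^ 2 / (1 + (q + s)⁻¹))) * (2 * σ) * B ^ (2 * σ - 1)) q := by
    have h3 : HasDerivAt (fun t : ℝ => t + s) 1 q := (hasDerivAt_id q).add_const s
    have h4 := ((((h3.fun_inv hqs.ne').const_add 1).log (by positivity)).const_mul (1 / 2)
      ).const_add (1 + 8 * σ)
    exact h4.rpow_const (Or.inl hB0.ne')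
  have h5 : HasFDerivAt (logWeight σ s : Rn n → ℝ) _ x :=
    HasDerivAt.comp_hasFDerivAt (f := fun y : Rn n => ‖y‖ ^ 2) x h2 h1
  have h6 : -fderiv ℝ (logWeight σ s) x x =
      2 * σ * B ^ (2 * σ - 1) * (q / ((q + s) * (q + s + 1))) := by
    rw [h5.fderiv]
    simp only [smul_apply, nsmul_eq_mul, innerSL_apply_apply, real_inner_self_eq_norm_sq,
      smul_eq_mul, ← hq]
    push_cast
    field_simp
  have h7 : q / ((q + s) * (q + s + 1)) ≤ 1 := by
    rw [div_le_one (by positivity)]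
    nlinarith
  have h8 : logWeight σ s x = B ^ (2 * σ - 1) * B := by
    rw [Real.rpow_sub_one hB0.ne', div_mul_cancel₀ _ hB0.ne']
    rfl
  have h9 : 0 ≤ B ^ (2 * σ - 1) := Real.rpow_nonneg hB0.le _
  rw [h6, h8]
  calc 2 * σ * B ^ (2 * σ - 1) * (q / ((q + s) * (q + s + 1)))
      ≤ 2 * σ * B ^ (2 * σ - 1) * 1 := by gcongr
    _ ≤ 1 / 4 * (B ^ (2 * σ - 1) * B) := by nlinarith

/-- The halved logarithm of the inverse square is |log |x||, up to a bounded error. What matters is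
that the constant does not depend on `s`. -/
lemma logWeight_le (hσ : 0 < σ) (hs : 0 < s) {x : Rn n} (hx : x ∈ Metric.ball (0 : Rn n) 1)
    (hx0 : x ≠ 0) :
    logWeight σ s x ≤ (2 + 8 * σ) ^ (2 * σ) * (1 + |Real.log ‖x‖|) ^ (2 * σ) := by
  have hx1 : ‖x‖ < 1 := mem_ball_zero_iff.1 hx
  have hxp : 0 < ‖x‖ := norm_pos_iff.2 hx0
  have hB := le_logWeight_base (σ := σ) hs x
  have hL : 0 ≤ |Real.log ‖x‖| := abs_nonneg _
  rw [← Real.mul_rpow (by positivity) (by positivity)]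
  refine Real.rpow_le_rpow (by linarith) ?_ (by positivity)
  have h1 : 1 + (‖x‖ ^ 2 + s)⁻¹ ≤ 2 * (‖x‖ ^ 2)⁻¹ := by
    have h2 : (‖x‖ ^ 2 + s)⁻¹ ≤ (‖x‖ ^ 2)⁻¹ := inv_anti₀ (by positivity) (by linarith)
    have h3 : 1 ≤ (‖x‖ ^ 2)⁻¹ := (one_le_inv₀ (by positivity)).2 (by nlinarith)
    linarith
  have h4 : Real.log (1 + (‖x‖ ^ 2 + s)⁻¹) ≤ Real.log 2 + 2 * |Real.log ‖x‖| := by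
    refine (Real.log_le_log (by positivity) h1).trans ?_
    rw [Real.log_mul (by norm_num) (by positivity), Real.log_inv, Real.log_pow]
    push_cast
    linarith [neg_le_abs (Real.log ‖x‖)]
  have h5 : Real.log 2 ≤ 1 := by linarith [Real.log_two_lt_d9]
  nlinarith

/-- The regularized weights become arbitrarily large near the origin. -/
lemma exists_le_logWeight (n : ℕ) (hσ : 0 < σ) (R : ℝ) : ∃ s > 0, ∃ δ > 0,
    ∀ x : Rn n, ‖x‖ < δ → R ≤ logWeight σ s x := by
  have h1 : Filter.Tendsto (fun t : ℝ => (1 / 2 * Real.log t) ^ (2 * σ)) Filter.atTop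
      Filter.atTop :=
    (tendsto_rpow_atTop (by positivity)).comp
      (Real.tendsto_log_atTop.const_mul_atTop (by norm_num))
  obtain ⟨t, ht, ht1⟩ := ((h1.eventually_ge_atTop R).and (Filter.eventually_gt_atTop 1)).exists
  have ht0 : 0 < t := by linarith
  -- With these choices |x|² and `s` are each at most 1/(2t), so the argument of the logarithm
  -- exceeds `t`.
  refine ⟨(2 * t)⁻¹, by positivity, Real.sqrt (2 * t)⁻¹, by positivity, fun x hx => ht.trans ?_⟩
  have h2 : ‖x‖ ^ 2 ≤ (2 * t)⁻¹ := ((Real.lt_sqrt (norm_nonneg x)).1 hx).le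
  have h3 : t ≤ (‖x‖ ^ 2 + (2 * t)⁻¹)⁻¹ := by
    rw [le_inv_comm₀ ht0 (by positivity)]
    have : (2 * t)⁻¹ + (2 * t)⁻¹ = t⁻¹ := by field_simp; norm_num
    linarith
  have h4 : Real.log t ≤ Real.log (1 + (‖x‖ ^ 2 + (2 * t)⁻¹)⁻¹) :=
    Real.log_le_log ht0 (by linarith)
  have h5 : 0 ≤ Real.log t := Real.log_nonneg ht1.le
  exact Real.rpow_le_rpow (by positivity) (by linarith) (by positivity)

end LogWeight

/-- Functions of the unit ball of `E^m_{2,σ}(B)` do not concentrate at the origin. -/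
lemma exists_integral_ball_le (n m : ℕ) [NeZero n] [NeZero m] {σ : ℝ} (hσ : 0 < σ) {η : ℝ}
    (hη : 0 < η) : ∃ δ > 0, ∀ u : testSpace n m,
      ∫ x in Metric.ball (0 : Rn n) δ, ‖u.1 x‖ ^ 2 ≤ η * ‖testToE n m σ u‖ ^ 2 := by
  have hn : (0 : ℝ) < n := by exact_mod_cast Nat.pos_of_ne_zero (NeZero.ne n)
  set C : ℝ := (8 * n) ^ m * (2 + 8 * σ) ^ (2 * σ) with hC
  have hC0 : 0 < C := by positivity
  -- `C` is the Hardy constant for every `s`, so `s` may be chosen after it, making the weight at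
  -- least `C / η` near the origin.
  obtain ⟨s, hs, δ, hδ, hR⟩ := exists_le_logWeight n hσ (C / η)
  refine ⟨δ, hδ, fun u => ?_⟩
  obtain ⟨hu, hc, -⟩ := u.2
  have hcu := hu.continuous
  have hcw := (contDiff_logWeight (n := n) hσ hs).continuous
  have h1 := integral_listDeriv_le (m := m) (σ := σ) (D := (2 + 8 * σ) ^ (2 * σ)) (by positivity)
    (contDiff_logWeight (n := n) hσ hs) (logWeight_nonneg hσ hs) (neg_fderiv_logWeight_le hσ hs)
    (fun x => logWeight_le hσ hs) u m [] (by simp)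
  simp only [List.length_nil, mul_zero, pow_zero, one_mul, listDeriv, List.foldr_nil,
    ← mul_assoc] at h1
  have hsq : HasCompactSupport fun x => ‖u.1 x‖ ^ 2 :=
    hc.comp_left (g := fun z : ℂ => ‖z‖ ^ 2) (by simp)
  have hint : Integrable fun x : Rn n => logWeight σ s x * ‖u.1 x‖ ^ 2 :=
    Continuous.integrable_of_hasCompactSupport (by fun_prop) hsq.mul_left
  have hint' : Integrable fun x : Rn n => C / η * ‖u.1 x‖ ^ 2 :=
    Continuous.integrable_of_hasCompactSupport (by fun_prop) hsq.mul_left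
  have h2 : ∫ x in Metric.ball (0 : Rn n) δ, C / η * ‖u.1 x‖ ^ 2 ≤
      ∫ x in Metric.ball (0 : Rn n) δ, logWeight σ s x * ‖u.1 x‖ ^ 2 :=
    setIntegral_mono_on hint'.integrableOn hint.integrableOn Metric.isOpen_ball.measurableSet
      fun x hx => mul_le_mul_of_nonneg_right (hR x (mem_ball_zero_iff.1 hx)) (sq_nonneg _)
  have h3 : ∫ x in Metric.ball (0 : Rn n) δ, logWeight σ s x * ‖u.1 x‖ ^ 2 ≤
      ∫ x, logWeight σ s x * ‖u.1 x‖ ^ 2 :=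
    setIntegral_le_integral hint (Filter.Eventually.of_forall fun x =>
      mul_nonneg (logWeight_nonneg hσ hs x) (sq_nonneg _))
  have h4 := (h2.trans h3).trans h1
  rw [integral_const_mul, div_mul_eq_mul_div, div_le_iff₀ hη] at h4
  refine le_of_mul_le_mul_left (h4.trans_eq ?_) hC0
  simp only [hC]
  ring

/-! ### Compact integral operators -/

lemma isCompactOperator_of_forall_exists {X Y : Type*} [NormedAddCommGroup X] [NormedSpace ℂ X]
    [NormedAddCommGroup Y] [NormedSpace ℂ Y] [CompleteSpace Y] {T : X →L[ℂ] Y}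
    (h : ∀ ε > 0, ∃ S : X →L[ℂ] Y, IsCompactOperator S ∧ ‖T - S‖ ≤ ε) : IsCompactOperator T := by
  have hcl : T ∈ closure {S : X →L[ℂ] Y | IsCompactOperator S} := by
    rw [Metric.mem_closure_iff]
    intro ε hε
    obtain ⟨S, hS, hTS⟩ := h (ε / 2) (by positivity)
    exact ⟨S, hS, by rw [dist_eq_norm]; linarith⟩
  rwa [isClosed_setOfPred_isCompactOperator.closure_eq] at hcl

section KernelOperator

variable {Ω : Type*} [MeasurableSpace Ω] {μ : Measure Ω} [IsFiniteMeasure μ] {H : Type*}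
  [NormedAddCommGroup H] [InnerProductSpace ℂ H]

lemma memLp_inner_kernel {Φ : Ω → H} (hΦ : AEStronglyMeasurable Φ μ) {M : ℝ}
    (hM : ∀ x, ‖Φ x‖ ≤ M) (f : H) : MemLp (fun x => inner ℂ (Φ x) f) 2 μ :=
  MemLp.of_bound (hΦ.inner aestronglyMeasurable_const) (M * ‖f‖)
    (Filter.Eventually.of_forall fun x => (norm_inner_le_norm _ _).trans
      (mul_le_mul_of_nonneg_right (hM x) (norm_nonneg f)))

/-- The operator `f ↦ (x ↦ (Φ x, f))` from `H` to `L₂(μ)` for a bounded kernel `Φ : Ω → H`. -/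
def kernelOp {Φ : Ω → H} (hΦ : AEStronglyMeasurable Φ μ) {M : ℝ} (hM : ∀ x, ‖Φ x‖ ≤ M) :
    H →L[ℂ] Lp ℂ 2 μ :=
  LinearMap.mkContinuous
    { toFun := fun f => (memLp_inner_kernel hΦ hM f).toLp _
      map_add' := fun f g => by
        rw [← MemLp.toLp_add]
        exact MemLp.toLp_congr _ _ (Filter.Eventually.of_forall fun x => inner_add_right _ _ _)
      map_smul' := fun c f => by
        rw [RingHom.id_apply, ← MemLp.toLp_const_smul]
        exact MemLp.toLp_congr _ _
          (Filter.Eventually.of_forall fun x => inner_smul_right _ _ _) }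
    ((measureUnivNNReal μ : ℝ) ^ (2 : ℝ≥0∞).toReal⁻¹ * |M|) fun f => by
      rw [mul_assoc]
      refine Lp.norm_le_of_ae_bound (by positivity) ?_
      filter_upwards [(memLp_inner_kernel hΦ hM f).coeFn_toLp] with x hx
      refine (congrArg norm hx).trans_le ((norm_inner_le_norm _ _).trans ?_)
      have := (hM x).trans (le_abs_self M)
      gcongr

lemma coeFn_kernelOp {Φ : Ω → H} (hΦ : AEStronglyMeasurable Φ μ) {M : ℝ} (hM : ∀ x, ‖Φ x‖ ≤ M)
    (f : H) : kernelOp hΦ hM f =ᵐ[μ] fun x => inner ℂ (Φ x) f :=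
  (memLp_inner_kernel hΦ hM f).coeFn_toLp

/-- A kernel operator whose kernel takes values in a compact set is compact. -/
lemma isCompactOperator_kernelOp {Φ : Ω → H} (hΦ : AEStronglyMeasurable Φ μ) {M : ℝ}
    (hM : ∀ x, ‖Φ x‖ ≤ M) {C : Set H} (hC : IsCompact C) (hΦC : ∀ x, Φ x ∈ C) :
    IsCompactOperator (kernelOp hΦ hM) := by
  refine isCompactOperator_of_forall_exists fun ε hε => ?_
  set c : ℝ := (measureUnivNNReal μ : ℝ) ^ (2 : ℝ≥0∞).toReal⁻¹ with hc
  have hc0 : 0 ≤ c := by positivity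
  -- Projecting the kernel onto the span of a finite net of `C` gives an operator that factors
  -- through a finite-dimensional space. The denominator absorbs `c`, the square root of the total
  -- mass, and `+ 1` keeps it non-zero.
  obtain ⟨t, -, htfin, htC⟩ := hC.finite_cover_balls (e := ε / (c + 1)) (by positivity)
  let V : Submodule ℂ H := Submodule.span ℂ t
  have : FiniteDimensional ℂ V := FiniteDimensional.span_of_finite ℂ htfin
  let P := V.starProjection
  refine ⟨kernelOp hΦ hM ∘L P, ?_, ?_⟩
  · have : LocallyCompactSpace V := by
      have := FiniteDimensional.proper ℂ V
      infer_instance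
    have h1 : IsCompactOperator V.subtypeL := isCompactOperator_of_locallyCompactSpace_rng _
    exact (h1.comp_clm V.orthogonalProjectionOnto).clm_comp (kernelOp hΦ hM)
  · refine ContinuousLinearMap.opNorm_le_bound _ hε.le fun f => ?_
    have hΦP : ∀ x, ‖Φ x - P (Φ x)‖ ≤ ε / (c + 1) := by
      intro x
      obtain ⟨y, hy, hxy⟩ := Set.mem_iUnion₂.1 (htC (hΦC x))
      have hPy : P y = y := Submodule.starProjection_eq_self_iff.2 (Submodule.subset_span hy)
      have h1 : Φ x - P (Φ x) = Vᗮ.starProjection (Φ x - y) := by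
        rw [Submodule.starProjection_orthogonal_val, map_sub, hPy]
        abel
      rw [h1]
      refine (Submodule.norm_starProjection_apply_le _ _).trans ?_
      rw [← dist_eq_norm]
      exact (Metric.mem_ball.1 hxy).le
    have hae : ∀ᵐ x ∂μ, ‖((kernelOp hΦ hM - kernelOp hΦ hM ∘L P) f : Ω → ℂ) x‖ ≤
        ε / (c + 1) * ‖f‖ := by
      filter_upwards [coeFn_kernelOp hΦ hM f, coeFn_kernelOp hΦ hM (P f),
        Lp.coeFn_sub (kernelOp hΦ hM f) (kernelOp hΦ hM (P f))] with x h1 h2 h3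
      have h4 : ((kernelOp hΦ hM - kernelOp hΦ hM ∘L P) f : Ω → ℂ) x =
          inner ℂ (Φ x - P (Φ x)) f := by
        refine h3.trans ?_
        rw [Pi.sub_apply, h1, h2, inner_sub_left, Submodule.inner_starProjection_left_eq_right]
      rw [h4]
      exact (norm_inner_le_norm _ _).trans (mul_le_mul_of_nonneg_right (hΦP x) (norm_nonneg f))
    refine (Lp.norm_le_of_ae_bound (by positivity) hae).trans ?_
    rw [← hc, ← mul_assoc]
    refine mul_le_mul_of_nonneg_right ?_ (norm_nonneg f)
    rw [mul_div_assoc', div_le_iff₀ (by positivity)]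
    nlinarith

end KernelOperator

/-! ### Translation estimates -/

/-- Jensen's inequality for the square, from the monotonicity of L^p norms on a probability space.
-/
lemma _root_.MeasureTheory.enorm_integral_sq_le {Ω G : Type*} [MeasurableSpace Ω]
    [NormedAddCommGroup G] [NormedSpace ℝ G] {μ : Measure Ω} [IsProbabilityMeasure μ] {f : Ω → G}
    (hf : AEStronglyMeasurable f μ) : ‖∫ x, f x ∂μ‖ₑ ^ 2 ≤ ∫⁻ x, ‖f x‖ₑ ^ 2 ∂μ := by
  have h1 : ‖∫ x, f x ∂μ‖ₑ ≤ eLpNorm f 2 μ :=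
    (enorm_integral_le_lintegral_enorm f).trans
      ((eLpNorm_one_eq_lintegral_enorm (f := f) (μ := μ)).symm.trans_le
        (eLpNorm_le_eLpNorm_of_exponent_le one_le_two hf))
  refine (pow_le_pow_left' h1 2).trans_eq ?_
  have h2 := eLpNorm_nnreal_pow_eq_lintegral (f := f) (μ := μ) (p := 2) two_ne_zero
  simpa using h2

/-- `∑ |∂ᵢ u|²` with the weight `|x|²`. -/
def radialGradSq (u : Rn n → ℂ) (x : Rn n) : ℝ := ‖x‖ ^ 2 * ∑ i, ‖partialDeriv i u x‖ ^ 2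

lemma radialGradSq_nonneg (u : Rn n → ℂ) (x : Rn n) : 0 ≤ radialGradSq u x :=
  mul_nonneg (sq_nonneg _) (Finset.sum_nonneg fun _ _ => sq_nonneg _)

lemma continuous_radialGradSq {u : Rn n → ℂ} (hu : ContDiff ℝ 1 u) :
    Continuous (radialGradSq u) := by
  have : ∀ i, Continuous (partialDeriv i u) := fun i =>
    (contDiff_partialDeriv (k := 0) i hu).continuous
  unfold radialGradSq
  fun_prop

/-- The fundamental theorem of calculus along the segment from `x` to `x - y`. The segment stays at
distance at least δ/2 from the origin, so the weight |z|² can be inserted at the cost of 4/δ². -/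
lemma enorm_sub_sq_le_lintegral {u : Rn n → ℂ} (hu : ContDiff ℝ 1 u) {δ h : ℝ} (hδ : 0 < δ)
    (hh : h ≤ δ / 2) {x y : Rn n} (hx : δ ≤ ‖x‖) (hy : ‖y‖ ≤ h) :
    ‖u x - u (x - y)‖ₑ ^ 2 ≤ ENNReal.ofReal (4 * h ^ 2 / δ ^ 2) *
      ∫⁻ t in Set.Ioc (0 : ℝ) 1, ENNReal.ofReal (radialGradSq u (x - t • y)) := by
  have hdu : Continuous (fderiv ℝ u) := hu.continuous_fderiv (by simp)
  have hcont : Continuous fun t : ℝ => fderiv ℝ u (x - t • y) y := by fun_prop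
  have hneg : Continuous fun t : ℝ => -fderiv ℝ u (x - t • y) y := hcont.neg
  have hder : ∀ t : ℝ, HasDerivAt (fun t : ℝ => u (x - t • y)) (-fderiv ℝ u (x - t • y) y) t := by
    intro t
    have h1 : HasDerivAt (fun t : ℝ => x - t • y) (-((1 : ℝ) • y)) t :=
      ((hasDerivAt_id t).smul_const y).const_sub x
    have h2 := ((hu.differentiable (by simp) (x - t • y)).hasFDerivAt).comp_hasDerivAt t h1
    rw [one_smul, map_neg] at h2
    exact h2
  have hFTC := intervalIntegral.integral_eq_sub_of_hasDerivAt (a := 0) (b := 1)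
    (fun t _ => hder t) (hneg.intervalIntegrable _ _)
  rw [intervalIntegral.integral_of_le zero_le_one, one_smul, zero_smul, sub_zero] at hFTC
  have : IsProbabilityMeasure (volume.restrict (Set.Ioc (0 : ℝ) 1)) := ⟨by simp⟩
  have h3 := enorm_integral_sq_le (μ := volume.restrict (Set.Ioc (0 : ℝ) 1))
    hneg.aestronglyMeasurable
  rw [hFTC, ← enorm_neg, neg_sub] at h3
  refine h3.trans ?_
  rw [← lintegral_const_mul' _ _ ENNReal.ofReal_ne_top]
  refine setLIntegral_mono' measurableSet_Ioc fun t ht => ?_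
  rw [enorm_neg, ← ofReal_norm, ← ENNReal.ofReal_pow (norm_nonneg _),
    ← ENNReal.ofReal_mul (by positivity)]
  refine ENNReal.ofReal_le_ofReal ?_
  set z := x - t • y with hz
  have hz1 : δ / 2 ≤ ‖z‖ := by
    have h4 : ‖t • y‖ ≤ h := by
      rw [norm_smul, Real.norm_of_nonneg ht.1.le]
      nlinarith [ht.2, norm_nonneg y]
    have h5 := norm_sub_norm_le x (t • y)
    rw [← hz] at h5
    linarith
  set G := ∑ i, ‖partialDeriv i u z‖ ^ 2
  have hG : 0 ≤ G := Finset.sum_nonneg fun _ _ => sq_nonneg _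
  calc ‖fderiv ℝ u z y‖ ^ 2 ≤ ‖y‖ ^ 2 * G := norm_fderiv_self_sq_le u z y
    _ ≤ h ^ 2 * G := by gcongr
    _ = 4 * h ^ 2 / δ ^ 2 * ((δ / 2) ^ 2 * G) := by field_simp; ring
    _ ≤ 4 * h ^ 2 / δ ^ 2 * (‖z‖ ^ 2 * G) := by gcongr

/-- Away from the origin a function is close to its averages over small balls. -/
lemma lintegral_sub_average_sq_le {u : Rn n → ℂ} (hu : ContDiff ℝ 1 u) {δ h : ℝ} (hδ : 0 < δ)
    (hh : h ≤ δ / 2) {ν : Measure (Rn n)} [IsProbabilityMeasure ν] (hν : ∀ᵐ y ∂ν, ‖y‖ ≤ h)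
    (hint : ∀ x, Integrable (fun y => u (x - y)) ν) :
    ∫⁻ x in {x : Rn n | δ ≤ ‖x‖}, ‖u x - ∫ y, u (x - y) ∂ν‖ₑ ^ 2 ≤
      ENNReal.ofReal (4 * h ^ 2 / δ ^ 2) * ∫⁻ x, ENNReal.ofReal (radialGradSq u x) := by
  have hcu := hu.continuous
  have hcG := continuous_radialGradSq hu
  have hmeas : MeasurableSet {x : Rn n | δ ≤ ‖x‖} := measurableSet_le measurable_const measurable_norm
  calc ∫⁻ x in {x : Rn n | δ ≤ ‖x‖}, ‖u x - ∫ y, u (x - y) ∂ν‖ₑ ^ 2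
      ≤ ∫⁻ x in {x : Rn n | δ ≤ ‖x‖}, ∫⁻ y, ‖u x - u (x - y)‖ₑ ^ 2 ∂ν := by
        refine lintegral_mono fun x => ?_
        have h1 : u x - ∫ y, u (x - y) ∂ν = ∫ y, (u x - u (x - y)) ∂ν := by
          rw [integral_sub (integrable_const _) (hint x)]
          simp
        rw [h1]
        exact enorm_integral_sq_le (by fun_prop)
    _ = ∫⁻ y, ∫⁻ x in {x : Rn n | δ ≤ ‖x‖}, ‖u x - u (x - y)‖ₑ ^ 2 ∂volume ∂ν := by
        refine lintegral_lintegral_swap (Continuous.measurable ?_).aemeasurable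
        simp only [Function.uncurry_def]
        fun_prop
    _ ≤ ∫⁻ _, (ENNReal.ofReal (4 * h ^ 2 / δ ^ 2) *
          ∫⁻ x, ENNReal.ofReal (radialGradSq u x)) ∂ν := by
        refine lintegral_mono_ae ?_
        filter_upwards [hν] with y hy
        calc ∫⁻ x in {x : Rn n | δ ≤ ‖x‖}, ‖u x - u (x - y)‖ₑ ^ 2
            ≤ ∫⁻ x in {x : Rn n | δ ≤ ‖x‖}, ENNReal.ofReal (4 * h ^ 2 / δ ^ 2) *
                ∫⁻ t in Set.Ioc (0 : ℝ) 1, ENNReal.ofReal (radialGradSq u (x - t • y)) :=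
              setLIntegral_mono' hmeas fun x hx => enorm_sub_sq_le_lintegral hu hδ hh hx hy
          _ ≤ ∫⁻ x, ENNReal.ofReal (4 * h ^ 2 / δ ^ 2) *
                ∫⁻ t in Set.Ioc (0 : ℝ) 1, ENNReal.ofReal (radialGradSq u (x - t • y)) :=
              setLIntegral_le_lintegral _ _
          _ = ENNReal.ofReal (4 * h ^ 2 / δ ^ 2) * ∫⁻ t in Set.Ioc (0 : ℝ) 1,
                ∫⁻ x, ENNReal.ofReal (radialGradSq u (x - t • y)) := by
              rw [lintegral_const_mul' _ _ ENNReal.ofReal_ne_top]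
              congr 1
              refine lintegral_lintegral_swap (Continuous.measurable ?_).aemeasurable
              exact ENNReal.continuous_ofReal.comp
                (hcG.comp (by fun_prop : Continuous fun p : Rn n × ℝ => p.1 - p.2 • y))
          _ = ENNReal.ofReal (4 * h ^ 2 / δ ^ 2) * ∫⁻ x, ENNReal.ofReal (radialGradSq u x) := by
              congr 1
              -- After Tonelli, translation invariance removes the dependence on `t` and `y`. This
              -- is why the integral was enlarged to the whole space.
              have h2 : ∀ t : ℝ, ∫⁻ x, ENNReal.ofReal (radialGradSq u (x - t • y)) =
                  ∫⁻ x, ENNReal.ofReal (radialGradSq u x) := fun t =>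
                lintegral_sub_right_eq_self (fun x => ENNReal.ofReal (radialGradSq u x)) _
              simp [h2]
    _ = _ := by simp

/-! ### Compactness of the embedding -/

lemma memLp_translate {φ : Rn n → ℝ} (hφ : Continuous φ) (hc : HasCompactSupport φ) (x : Rn n) :
    MemLp (fun y => (φ (x - y) : ℂ)) 2 (ballMeasure n) := by
  obtain ⟨M, hM⟩ := hφ.bounded_above_of_compact_support hc
  refine MemLp.of_bound (by fun_prop) M (Filter.Eventually.of_forall fun y => ?_)
  rw [Complex.norm_real]
  exact hM _

/-- The kernel `x ↦ φ (x - ·)` of a convolution operator. -/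
def convKernel {φ : Rn n → ℝ} (hφ : Continuous φ) (hc : HasCompactSupport φ) (x : Rn n) : L2B n :=
  (memLp_translate hφ hc x).toLp _

/-- Uniform continuity of `φ` makes the translates close in the sup norm, hence in L₂ of the finite
measure. Continuity supplies the compact set of kernel values. -/
lemma continuous_convKernel {φ : Rn n → ℝ} (hφ : Continuous φ) (hc : HasCompactSupport φ) :
    Continuous (convKernel hφ hc) := by
  rw [Metric.continuous_iff]
  intro x ε hε
  set c : ℝ := (measureUnivNNReal (ballMeasure n) : ℝ) ^ (2 : ℝ≥0∞).toReal⁻¹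
  have hc0 : 0 ≤ c := by positivity
  obtain ⟨δ, hδ, hφδ⟩ := Metric.uniformContinuous_iff.1 (hc.uniformContinuous_of_continuous hφ)
    (ε / (c + 1)) (by positivity)
  refine ⟨δ, hδ, fun z hz => ?_⟩
  rw [dist_eq_norm]
  have h1 : ‖convKernel hφ hc z - convKernel hφ hc x‖ ≤ c * (ε / (c + 1)) := by
    refine Lp.norm_le_of_ae_bound (by positivity) ?_
    filter_upwards [Lp.coeFn_sub (convKernel hφ hc z) (convKernel hφ hc x),
      (memLp_translate hφ hc z).coeFn_toLp, (memLp_translate hφ hc x).coeFn_toLp] with y h2 h3 h4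
    have h5 : (convKernel hφ hc z : Rn n → ℂ) y - (convKernel hφ hc x : Rn n → ℂ) y =
        ((φ (z - y) - φ (x - y) : ℝ) : ℂ) := by
      push_cast
      exact congrArg₂ _ h3 h4
    rw [h2, Pi.sub_apply, h5, Complex.norm_real, ← dist_eq_norm]
    refine (hφδ ?_).le
    rwa [dist_sub_right]
  refine h1.trans_lt ?_
  rw [mul_div_assoc', div_lt_iff₀ (by positivity)]
  nlinarith

/-- Averaging over small balls, away from the origin, is a compact operator in `L₂(B)`. -/
lemma exists_isCompactOperator_average (n m : ℕ) (δ : ℝ) {h : ℝ} (hh : 0 < h) :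
    ∃ (S : L2B n →L[ℂ] L2B n) (ν : Measure (Rn n)), IsCompactOperator S ∧
      IsProbabilityMeasure ν ∧ (∀ᵐ y ∂ν, ‖y‖ ≤ h) ∧ ∀ u : testSpace n m,
        S (testToL2 n m u) =ᵐ[ballMeasure n]
          {x : Rn n | δ ≤ ‖x‖}.indicator fun x => ∫ y, u.1 (x - y) ∂ν := by
  let bump : ContDiffBump (0 : Rn n) := ⟨h / 2, h, by positivity, by linarith⟩
  set φ : Rn n → ℝ := bump.normed volume with hφ
  have hφc : Continuous φ := bump.continuous_normed
  have hφs : HasCompactSupport φ := bump.hasCompactSupport_normed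
  have hφ0 : ∀ y, 0 ≤ φ y := fun y => bump.nonneg_normed y
  have hφ1 : ∫ y, φ y = 1 := bump.integral_normed
  have hmeas : Measurable fun y => ENNReal.ofReal (φ y) := hφc.measurable.ennreal_ofReal
  set ν : Measure (Rn n) := volume.withDensity fun y => ENNReal.ofReal (φ y) with hν
  have hA : MeasurableSet ({x : Rn n | δ ≤ ‖x‖} ∩ Metric.closedBall 0 1) :=
    (measurableSet_le measurable_const measurable_norm).inter Metric.isClosed_closedBall.measurableSet
  -- The compactness criterion concerns all values of the kernel, so it is also cut off outside the
  -- closed unit ball; the cut-offs add only the value 0.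
  set Φ : Rn n → L2B n :=
    ({x : Rn n | δ ≤ ‖x‖} ∩ Metric.closedBall 0 1).indicator (convKernel hφc hφs) with hΦ
  have hcont := continuous_convKernel hφc hφs
  have hΦm : AEStronglyMeasurable Φ (ballMeasure n) :=
    hcont.aestronglyMeasurable.indicator hA
  set C : Set (L2B n) := insert 0 (convKernel hφc hφs '' Metric.closedBall 0 1)
  have hC : IsCompact C := ((isCompact_closedBall 0 1).image hcont).insert 0
  have hΦC : ∀ x, Φ x ∈ C := by
    intro x
    by_cases hx : x ∈ {x : Rn n | δ ≤ ‖x‖} ∩ Metric.closedBall 0 1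
    · rw [hΦ, Set.indicator_of_mem hx]
      exact Set.mem_insert_of_mem _ ⟨x, hx.2, rfl⟩
    · rw [hΦ, Set.indicator_of_notMem hx]
      exact Set.mem_insert _ _
  obtain ⟨M, hM⟩ := hC.isBounded.exists_norm_le
  refine ⟨kernelOp hΦm fun x => hM _ (hΦC x), ν,
    isCompactOperator_kernelOp hΦm _ hC hΦC, ⟨?_⟩, ?_, fun u => ?_⟩
  · rw [hν, withDensity_apply _ MeasurableSet.univ, Measure.restrict_univ,
      ← ofReal_integral_eq_lintegral_ofReal (hφc.integrable_of_hasCompactSupport hφs)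
        (Filter.Eventually.of_forall hφ0), hφ1, ENNReal.ofReal_one]
  · rw [hν, ae_withDensity_iff hmeas]
    refine Filter.Eventually.of_forall fun y hy => ?_
    have h1 : y ∈ Function.support φ := fun h0 => hy (by rw [h0, ENNReal.ofReal_zero])
    rw [hφ, bump.support_normed_eq] at h1
    exact (mem_ball_zero_iff.1 h1).le
  · obtain ⟨hu, hc, hs⟩ := u.2
    filter_upwards [coeFn_kernelOp hΦm (fun x => hM _ (hΦC x)) (testToL2 n m u),
      ae_restrict_mem Metric.isOpen_ball.measurableSet] with x hx hxB
    rw [hx]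
    by_cases hxδ : δ ≤ ‖x‖
    · rw [Set.indicator_of_mem (by exact hxδ), hΦ,
        Set.indicator_of_mem (show x ∈ {x : Rn n | δ ≤ ‖x‖} ∩ Metric.closedBall 0 1 from
          ⟨hxδ, Metric.ball_subset_closedBall hxB⟩)]
      refine (inner_toLp_ofReal (φ := fun y => φ (x - y)) (memLp_translate hφc hφs x)
        (testToL2 n m u)).trans ?_
      have h1 : ∫ y, φ (x - y) • (testToL2 n m u : Rn n → ℂ) y ∂(ballMeasure n) =
          ∫ y in Metric.ball (0 : Rn n) 1, φ (x - y) • u.1 y := by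
        refine integral_congr_ae ?_
        filter_upwards [(memLp_testSpace u).coeFn_toLp] with y hy
        exact congrArg _ hy
      rw [h1, setIntegral_eq_integral_of_forall_compl_eq_zero fun y hy => by
          simp [image_eq_zero_of_notMem_tsupport fun h => hy (hs h)],
        integral_withDensity_eq_integral_toReal_smul hmeas
          (Filter.Eventually.of_forall fun _ => ENNReal.ofReal_lt_top),
        ← integral_sub_left_eq_self _ _ x]
      refine integral_congr_ae (Filter.Eventually.of_forall fun y => ?_)
      simp [ENNReal.toReal_ofReal (hφ0 _)]
    · rw [Set.indicator_of_notMem (by exact hxδ), hΦ,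
        Set.indicator_of_notMem fun h => hxδ h.1, inner_zero_left]

/-- Hardy's inequality with `g = 1`, stopped at first derivatives after `m - 1` steps. -/
lemma lintegral_radialGradSq_le [NeZero n] {m : ℕ} [NeZero m] {σ : ℝ} (hσ : 0 ≤ σ)
    (u : testSpace n m) : ∫⁻ x, ENNReal.ofReal (radialGradSq u.1 x) ≤
      ENNReal.ofReal (n * (8 * n) ^ (m - 1) * ‖testToE n m σ u‖ ^ 2) := by
  obtain ⟨hu, hc, -⟩ := u.2
  have hm : 1 ≤ m := NeZero.one_le
  have hu1 : ContDiff ℝ 1 u.1 := hu.of_le (by exact_mod_cast hm)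
  have hpi : ∀ i, Integrable fun x : Rn n => ‖x‖ ^ 2 * ‖partialDeriv i u.1 x‖ ^ 2 := by
    intro i
    have hp : HasCompactSupport (partialDeriv i u.1) :=
      hc.of_isClosed_subset isClosed_closure (tsupport_partialDeriv i u.1)
    have hpc : Continuous (partialDeriv i u.1) := (contDiff_partialDeriv (k := 0) i hu1).continuous
    exact Continuous.integrable_of_hasCompactSupport (by fun_prop)
      ((hp.comp_left (g := fun z : ℂ => ‖z‖ ^ 2) (by simp)).mul_left)
  have hsum : radialGradSq u.1 = fun x => ∑ i, ‖x‖ ^ 2 * ‖partialDeriv i u.1 x‖ ^ 2 := by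
    ext x
    rw [radialGradSq, Finset.mul_sum]
  have hint : Integrable (radialGradSq u.1) := by
    rw [hsum]
    exact integrable_finsetSum _ fun i _ => hpi i
  rw [← ofReal_integral_eq_lintegral_ofReal hint
    (Filter.Eventually.of_forall (radialGradSq_nonneg u.1))]
  refine ENNReal.ofReal_le_ofReal ?_
  rw [hsum, integral_finsetSum _ fun i _ => hpi i]
  have hterm : ∀ i ∈ (Finset.univ : Finset (Fin n)),
      ∫ x : Rn n, ‖x‖ ^ 2 * ‖partialDeriv i u.1 x‖ ^ 2 ≤
        (8 * n) ^ (m - 1) * ‖testToE n m σ u‖ ^ 2 := by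
    intro i _
    have h1 := integral_listDeriv_le (m := m) (σ := σ) (D := 1) zero_le_one
      (g := fun _ : Rn n => (1 : ℝ)) contDiff_const (fun _ => zero_le_one) (fun x => by simp)
      (fun x _ _ => by
        rw [one_mul]
        exact Real.one_le_rpow (by linarith [abs_nonneg (Real.log ‖x‖)]) (by positivity))
      u (m - 1) [i] (by simp; omega)
    simpa [listDeriv] using h1
  refine (Finset.sum_le_sum hterm).trans_eq ?_
  simp [mul_assoc]

lemma enorm_sq_eq_lintegral (f : L2B n) :
    ‖f‖ₑ ^ 2 = ∫⁻ x in Metric.ball (0 : Rn n) 1, ‖f x‖ₑ ^ 2 := by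
  have h2 := eLpNorm_nnreal_pow_eq_lintegral (f := (f : Rn n → ℂ)) (μ := ballMeasure n) (p := 2)
    two_ne_zero
  rw [Lp.enorm_def]
  simpa using h2

/-- The embedding `E^m_{2,σ}(B) → L₂(B)` is compact. -/
theorem isCompactOperator_embedding (n m : ℕ) [NeZero n] [NeZero m] {σ : ℝ} (hσ : 0 < σ) :
    IsCompactOperator (embedding n m σ) := by
  refine isCompactOperator_of_forall_exists fun ε hε => ?_
  have hn : (0 : ℝ) < n := by exact_mod_cast Nat.pos_of_ne_zero (NeZero.ne n)
  obtain ⟨δ, hδ, hconc⟩ := exists_integral_ball_le n m hσ (η := ε ^ 2 / 2) (by positivity)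
  set C : ℝ := n * (8 * n) ^ (m - 1) with hC
  have hC0 : 0 < C := by positivity
  -- The radius `δ` is fixed by the mass near the origin; only then is the averaging radius `h`
  -- chosen small relative to it. Each region is allotted half of `ε ^ 2`.
  obtain ⟨h, hh, hhδ, hhC⟩ : ∃ h > 0, h ≤ δ / 2 ∧ 4 * h ^ 2 / δ ^ 2 * C ≤ ε ^ 2 / 2 := by
    have h1 : Filter.Tendsto (fun h : ℝ => 4 * h ^ 2 / δ ^ 2 * C) (nhds 0) (nhds 0) := by
      have : Continuous fun h : ℝ => 4 * h ^ 2 / δ ^ 2 * C := by fun_prop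
      simpa using this.tendsto 0
    have h2 := (h1.eventually_lt_const (show 0 < ε ^ 2 / 2 by positivity)).and
      (eventually_lt_nhds (show 0 < δ / 2 by positivity))
    obtain ⟨r, hr, hball⟩ := Metric.eventually_nhds_iff.1 h2
    have h3 := hball (y := r / 2) (by
      rw [Real.dist_eq, sub_zero, abs_of_pos (by positivity)]; linarith)
    exact ⟨r / 2, by positivity, h3.2.le, h3.1.le⟩
  obtain ⟨S, ν, hS, hνp, hν, hSu⟩ := exists_isCompactOperator_average n m δ hh
  refine ⟨S ∘L embedding n m σ, hS.comp_clm _, ?_⟩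
  refine ContinuousLinearMap.opNorm_le_bound _ hε.le fun e => ?_
  -- Both sides are continuous in `e`, so test functions suffice; on them the embedding and the
  -- averages are explicit.
  refine (denseRange_testToE n m σ).induction_on
    (p := fun e => ‖(embedding n m σ - S ∘L embedding n m σ) e‖ ≤ ε * ‖e‖) e
    (isClosed_le (embedding n m σ - S ∘L embedding n m σ).continuous.norm
      (continuous_const.mul continuous_norm)) fun u => ?_
  obtain ⟨hu, hc, -⟩ := u.2
  have hcu := hu.continuous
  have hu1 : ContDiff ℝ 1 u.1 := hu.of_le (by exact_mod_cast (NeZero.one_le : 1 ≤ m))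
  rw [sub_apply, ContinuousLinearMap.comp_apply, embedding_testToE hσ.le]
  refine le_of_pow_le_pow_left₀ two_ne_zero (by positivity) ?_
  rw [← ENNReal.ofReal_le_ofReal_iff (by positivity), ENNReal.ofReal_pow (norm_nonneg _),
    ofReal_norm, enorm_sq_eq_lintegral]
  have hA : MeasurableSet {x : Rn n | δ ≤ ‖x‖} := measurableSet_le measurable_const measurable_norm
  have hae : ∀ᵐ x ∂(ballMeasure n), ((testToL2 n m u - S (testToL2 n m u) : L2B n) : Rn n → ℂ) x =
      u.1 x - {x : Rn n | δ ≤ ‖x‖}.indicator (fun x => ∫ y, u.1 (x - y) ∂ν) x := by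
    filter_upwards [hSu u, Lp.coeFn_sub (testToL2 n m u) (S (testToL2 n m u)),
      (memLp_testSpace u).coeFn_toLp] with x h1 h2 h3
    rw [h2, Pi.sub_apply, h1]
    exact congrArg (· - _) h3
  obtain ⟨M, hM⟩ := hcu.bounded_above_of_compact_support hc
  have hint : ∀ x, Integrable (fun y => u.1 (x - y)) ν := fun x =>
    Integrable.of_bound (by fun_prop) M (Filter.Eventually.of_forall fun y => hM _)
  have hfar : ∫⁻ x in {x : Rn n | δ ≤ ‖x‖}, ‖u.1 x - ∫ y, u.1 (x - y) ∂ν‖ₑ ^ 2 ≤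
      ENNReal.ofReal (ε ^ 2 / 2 * ‖testToE n m σ u‖ ^ 2) := by
    refine (lintegral_sub_average_sq_le hu1 hδ hhδ hν hint).trans ?_
    refine (mul_le_mul_right (lintegral_radialGradSq_le hσ.le u) _).trans ?_
    rw [← ENNReal.ofReal_mul (by positivity), ← mul_assoc]
    exact ENNReal.ofReal_le_ofReal (mul_le_mul_of_nonneg_right hhC (sq_nonneg _))
  have hnear : ∫⁻ x in Metric.ball (0 : Rn n) δ, ‖u.1 x‖ₑ ^ 2 ≤
      ENNReal.ofReal (ε ^ 2 / 2 * ‖testToE n m σ u‖ ^ 2) := by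
    refine le_trans (le_of_eq ?_) (ENNReal.ofReal_le_ofReal (hconc u))
    rw [ofReal_integral_eq_lintegral_ofReal]
    · refine lintegral_congr fun x => ?_
      rw [ENNReal.ofReal_pow (norm_nonneg _), ofReal_norm]
    · refine (Continuous.integrable_of_hasCompactSupport (by fun_prop) ?_).restrict
      exact hc.comp_left (g := fun z : ℂ => ‖z‖ ^ 2) (by simp)
    · exact Filter.Eventually.of_forall fun x => sq_nonneg _
  calc ∫⁻ x in Metric.ball (0 : Rn n) 1,
        ‖((testToL2 n m u - S (testToL2 n m u) : L2B n) : Rn n → ℂ) x‖ₑ ^ 2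
      = ∫⁻ x in Metric.ball (0 : Rn n) 1,
          ‖u.1 x - {x : Rn n | δ ≤ ‖x‖}.indicator (fun x => ∫ y, u.1 (x - y) ∂ν) x‖ₑ ^ 2 := by
        refine lintegral_congr_ae ?_
        filter_upwards [hae] with x hx
        rw [hx]
    _ ≤ ∫⁻ x, ‖u.1 x - {x : Rn n | δ ≤ ‖x‖}.indicator (fun x => ∫ y, u.1 (x - y) ∂ν) x‖ₑ ^ 2 :=
        setLIntegral_le_lintegral _ _
    _ ≤ ENNReal.ofReal (ε ^ 2 / 2 * ‖testToE n m σ u‖ ^ 2) +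
          ENNReal.ofReal (ε ^ 2 / 2 * ‖testToE n m σ u‖ ^ 2) := by
        rw [← lintegral_add_compl _ hA]
        refine add_le_add (le_trans (le_of_eq ?_) hfar) (le_trans (le_of_eq ?_) hnear)
        · refine setLIntegral_congr_fun hA fun x hx => ?_
          simp only [Set.indicator_of_mem hx]
        · have hAc : {x : Rn n | δ ≤ ‖x‖}ᶜ = Metric.ball 0 δ := by
            ext x
            simp
          rw [hAc]
          refine setLIntegral_congr_fun Metric.isOpen_ball.measurableSet fun x hx => ?_
          rw [← hAc] at hx
          simp only [Set.indicator_of_notMem hx, sub_zero]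
    _ = ENNReal.ofReal ((ε * ‖testToE n m σ u‖) ^ 2) := by
        rw [← ENNReal.ofReal_add (by positivity) (by positivity)]
        congr 1
        ring

/-! ### The operator generated by the inner product -/

/-- `L₂(B)` is infinite-dimensional: the indicator functions of concentric shells are
orthogonal. -/
lemma not_finiteDimensional_L2B (n : ℕ) [NeZero n] : ¬ FiniteDimensional ℂ (L2B n) := by
  intro hfin
  let r : ℕ → ℝ := fun k => ((k : ℝ) + 1)⁻¹
  have hr : ∀ k, 0 < r k := fun k => by positivity
  have hanti : StrictAnti r := fun i j hij =>
    inv_strictAnti₀ (by positivity) (by exact_mod_cast Nat.succ_lt_succ hij)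
  let A : ℕ → Set (Rn n) := fun k => {x | r (k + 1) < ‖x‖ ∧ ‖x‖ < r k}
  have hAo : ∀ k, IsOpen (A k) := fun k =>
    (isOpen_lt continuous_const continuous_norm).inter (isOpen_lt continuous_norm continuous_const)
  have hAB : ∀ k, A k ⊆ Metric.ball 0 1 := fun k x hx => by
    rw [mem_ball_zero_iff]
    refine hx.2.trans_le (inv_le_one_of_one_le₀ ?_)
    linarith [(Nat.cast_nonneg k : (0 : ℝ) ≤ k)]
  have hAne : ∀ k, (A k).Nonempty := by
    intro k
    obtain ⟨t, ht1, ht2⟩ := exists_between (hanti (Nat.lt_succ_self k))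
    have ht0 : 0 < t := (hr _).trans ht1
    refine ⟨EuclideanSpace.single (0 : Fin n) t, ?_⟩
    have : ‖(EuclideanSpace.single (0 : Fin n) t : Rn n)‖ = t := by
      simp [abs_of_pos ht0]
    exact ⟨by rw [this]; exact ht1, by rw [this]; exact ht2⟩
  have hdisj : ∀ i j, i < j → Disjoint (A i) (A j) := by
    intro i j hij
    rw [Set.disjoint_left]
    intro x hi hj
    have h1 := hanti.antitone (Nat.succ_le_of_lt hij)
    have h2 := hi.1
    have h3 := hj.2
    linarith
  have hμ : ∀ k, ballMeasure n (A k) ≠ 0 := by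
    intro k
    rw [Measure.restrict_apply (hAo k).measurableSet, Set.inter_eq_left.2 (hAB k)]
    exact ((hAo k).measure_pos volume (hAne k)).ne'
  let v : ℕ → L2B n := fun k =>
    indicatorConstLp 2 (hAo k).measurableSet (measure_ne_top (ballMeasure n) _) (1 : ℂ)
  have hv0 : ∀ k, v k ≠ 0 := by
    intro k h
    have h1 : ‖v k‖ = 0 := by rw [h, norm_zero]
    rw [norm_indicatorConstLp two_ne_zero ENNReal.ofNat_ne_top] at h1
    have h2 : 0 < (ballMeasure n).real (A k) :=
      ENNReal.toReal_pos (hμ k) (measure_ne_top _ _)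
    have h3 : 0 < (ballMeasure n).real (A k) ^ (1 / (2 : ℝ≥0∞).toReal) :=
      Real.rpow_pos_of_pos h2 _
    rw [norm_one, one_mul] at h1
    exact h3.ne' h1
  have hdisj' : Pairwise fun i j => Disjoint (A i) (A j) := fun i j hij =>
    hij.lt_or_gt.elim (hdisj i j) fun h => (hdisj j i h).symm
  have horth : Pairwise fun i j => inner ℂ (v i) (v j) = 0 := by
    intro i j hij
    rw [L2.inner_def]
    refine integral_eq_zero_of_ae ?_
    filter_upwards [indicatorConstLp_coeFn (p := 2) (hs := (hAo i).measurableSet)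
      (hμs := measure_ne_top (ballMeasure n) _) (c := (1 : ℂ)), indicatorConstLp_coeFn (p := 2)
      (hs := (hAo j).measurableSet) (hμs := measure_ne_top (ballMeasure n) _) (c := (1 : ℂ))]
      with x h1 h2
    have h1' : (v i : Rn n → ℂ) x = (A i).indicator (fun _ => (1 : ℂ)) x := h1
    have h2' : (v j : Rn n → ℂ) x = (A j).indicator (fun _ => (1 : ℂ)) x := h2
    rw [h1', h2']
    by_cases hx : x ∈ A i
    · rw [Set.indicator_of_notMem (Set.disjoint_left.1 (hdisj' hij) hx)]
      simp
    · rw [Set.indicator_of_notMem hx]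
      simp
  have hli := linearIndependent_of_ne_zero_of_inner_eq_zero hv0 horth
  exact absurd (hli.lt_aleph0_of_finiteDimensional) (by simp)

section

variable (n m : ℕ) [NeZero m] (σ : ℝ)

/-- The form identity characterizes `T† h`, so the element `u` in the relation can only be `T† h`.
-/
lemma mem_formGraph_iff (f h : L2B n) : (f, h) ∈ formGraph n m σ ↔
    f = (embedding n m σ ∘L ContinuousLinearMap.adjoint (embedding n m σ)) h := by
  constructor
  · rintro ⟨u, hu, huv⟩
    have h1 : ContinuousLinearMap.adjoint (embedding n m σ) h = u :=
      ext_inner_right ℂ fun v => by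
        rw [ContinuousLinearMap.adjoint_inner_left]
        exact huv v
    rw [ContinuousLinearMap.comp_apply, h1]
    exact hu.symm
  · rintro rfl
    exact ⟨_, rfl, fun v => (ContinuousLinearMap.adjoint_inner_left _ v h).symm⟩

variable {σ} [NeZero n]

lemma degenerateOp_graph_iff (hσ : 0 ≤ σ) (f h : L2B n) : (f, h) ∈ (degenerateOp n m σ).graph ↔
    f = (embedding n m σ ∘L ContinuousLinearMap.adjoint (embedding n m σ)) h := by
  rw [degenerateOp_graph n m hσ, mem_formGraph_iff]

/-- If `T T† h = 0`, then `(0, h)` lies in the form relation, which is single-valued. -/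
lemma embedding_comp_adjoint_injective (hσ : 0 ≤ σ) : Function.Injective
    (embedding n m σ ∘L ContinuousLinearMap.adjoint (embedding n m σ)) := by
  rw [injective_iff_map_eq_zero]
  intro h hh
  exact formGraph_single_valued n m hσ (0, h) ((mem_formGraph_iff n m σ 0 h).2 hh.symm) rfl

/-- For `f = T T† h` one has (A f, f) = ‖T† h‖², while ‖f‖ ≤ ‖T‖ ‖T† h‖. The `+ 1` in the constant
avoids a separate proof that `T ≠ 0`. -/
lemma isPositiveDefinite_degenerateOp (hσ : 0 ≤ σ) :
    IsPositiveDefinite (degenerateOp n m σ) := by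
  set T := embedding n m σ with hT
  refine ⟨(‖T‖ ^ 2 + 1)⁻¹, by positivity, fun f => ?_⟩
  set h := degenerateOp n m σ f with hh
  have hf : (f : L2B n) = T (ContinuousLinearMap.adjoint T h) :=
    (apply_apply_eq (degenerateOp_graph_iff n m hσ) f).symm
  have h1 : (inner ℂ h (f : L2B n)).re = ‖ContinuousLinearMap.adjoint T h‖ ^ 2 := by
    rw [hf, ← ContinuousLinearMap.adjoint_inner_left]
    exact inner_self_eq_norm_sq (𝕜 := ℂ) _
  rw [h1, hf, inv_mul_le_iff₀ (by positivity)]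
  refine (pow_le_pow_left₀ (norm_nonneg _) (T.le_opNorm _) 2).trans ?_
  rw [mul_pow]
  exact mul_le_mul_of_nonneg_right (by linarith) (sq_nonneg _)

end

end DegSobolev

end

/-! ### The main theorem -/

theorem proposition3p4 (n m : ℕ) [NeZero n] [NeZero m] (σ : ℝ) (hσ : 0 < σ) :
    IsCompactOperator (DegSobolev.embedding n m σ) ∧
    (∀ ε : ℝ, 0 < ε →
      DegSobolev.nuZero (DegSobolev.embedding n m σ) ε ≠ ⊤ ∧
      DegSobolev.nuZero (DegSobolev.embedding n m σ) ε =
        DegSobolev.muZero (DegSobolev.embedding n m σ) ε) ∧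
    IsSelfAdjoint (DegSobolev.degenerateOp n m σ) ∧
    DegSobolev.IsPositiveDefinite (DegSobolev.degenerateOp n m σ) ∧
    DegSobolev.HasPurePointSpectrum (DegSobolev.degenerateOp n m σ) ∧
    ∃ lam : ℕ → ℝ,
      DegSobolev.IsEigenvalueSequence (DegSobolev.degenerateOp n m σ) lam ∧
      Filter.Tendsto lam Filter.atTop Filter.atTop ∧
      ∀ ε : ℝ, 0 < ε →
        DegSobolev.nuZero (DegSobolev.embedding n m σ) ε =
          {k : ℕ | lam k ≤ (ε ^ 2)⁻¹}.encard := by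
  have hT := DegSobolev.isCompactOperator_embedding n m hσ
  have hKinj := DegSobolev.embedding_comp_adjoint_injective n m hσ.le
  have hgraph := DegSobolev.degenerateOp_graph_iff n m hσ.le
  have hadj : Function.Injective
      (ContinuousLinearMap.adjoint (DegSobolev.embedding n m σ)) :=
    Function.Injective.of_comp (f := DegSobolev.embedding n m σ) hKinj
  obtain ⟨x, b, s, hs, hb⟩ :=
    DegSobolev.exists_isSingularSystem (DegSobolev.not_finiteDimensional_L2B n) hT hadj
  have hsymm : (DegSobolev.embedding n m σ ∘L
      ContinuousLinearMap.adjoint (DegSobolev.embedding n m σ)).IsSymmetric :=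
    (ContinuousLinearMap.isPositive_self_comp_adjoint _).isSymmetric
  have hlim : Filter.Tendsto (fun k => s k ^ 2) Filter.atTop (nhds 0) := by
    simpa using hs.tendsto.pow 2
  obtain ⟨hpp, hseq, htop⟩ := DegSobolev.hasPurePointSpectrum_of_graph (ev := fun k => s k ^ 2)
    hgraph (hT.comp_clm _) hsymm (fun k => pow_pos (hs.pos k) 2)
    (fun i j hij => pow_le_pow_left₀ (hs.pos j).le (hs.antitone hij) 2) hlim hb
  refine ⟨hT, fun ε hε => ?_, DegSobolev.isSelfAdjoint_of_graph hgraph hsymm hKinj,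
    DegSobolev.isPositiveDefinite_degenerateOp n m hσ.le, hpp, _, hseq, htop, fun ε hε => ?_⟩
  · obtain ⟨N, hN⟩ := hs.exists_le_iff_lt hε
    rw [hs.nuZero_eq hN, hs.muZero_eq hε hN]
    exact ⟨ENat.natCast_ne_top N, rfl⟩
  · obtain ⟨N, hN⟩ := hs.exists_le_iff_lt hε
    -- The eigenvalue sequence is `(s k ^ 2)⁻¹`, so inversion turns this count into that of the
    -- singular values at least `ε`.
    have hset : {k : ℕ | (s k ^ 2)⁻¹ ≤ (ε ^ 2)⁻¹} = (Finset.range N : Set ℕ) := by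
      ext k
      rw [Set.mem_ofPred_eq, Finset.mem_coe, Finset.mem_range, ← hN,
        inv_le_inv₀ (pow_pos (hs.pos k) 2) (pow_pos hε 2),
        pow_le_pow_iff_left₀ hε.le (hs.pos k).le two_ne_zero]
    rw [hs.nuZero_eq hN, hset, Set.encard_coe_eq_coe_finsetCard, Finset.card_range]
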